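/- Let $k$ be a field, $R=k[x_1,\dots,x_n]$ and $I\subseteq R$ an ideal. For $\omega\in\mathbb{R}^n$ let $\mathrm{in}_\omega(f)$ be the sum of the terms of $f$ whose exponents maximize $\langle\omega,\cdot\rangle$, and put $\mathrm{in}_\omega(I)=\langle \mathrm{in}_\omega(f): f\in I\rangle$. For a term order $\prec$ on $R$ let $\mathrm{in}_\prec(I)$ be the ideal generated by the $\prec$-initial terms of the non-zero elements of $I$. Put $$C_v(I)=\overline{\{u\in\mathbb{R}^n:\mathrm{in}_u(I)=\mathrm{in}_v(I)\}},\qquad C_\prec(I)=\overline{\{u\in\mathbb{R}^n:\mathrm{in}_u(I)=\mathrm{in}_\prec(I)\}}.$$ The *Gröbner fan* of $I$ is the set of all $C_v(I)$ with $v\in\mathbb{R}^n_{>0}$ together with their non-empty faces, where a non-empty face of $P\subseteq\mathbb{R}^n$ is a non-empty set of maximizers of a linear form over $P$. A *fan* in $\mathbb{R}^n$ is a set of polyhedral cones $\{x: Ax\le 0\}$ that contains all non-empty faces of its members and in which the intersection of any two members is a face of both. It is *pure full-dimensional* if all its inclusion-maximal cones have dimension $n$. Its *graph* has the maximal cones as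 vertices, two distinct ones being adjacent if they share a common facet. A term order $\prec$ directs an edge between $C_1$ and $C_2$ with common facet $F$ from $C_1$ to $C_2$ if $\mathbf{x}^p\prec\mathbf{x}^q$ for $p,q\in\mathbb{N}^n$ such that $q-p\neq 0$ is a normal of $F$ that has negative inner product with all points of $C_1\setminus F$ and positive inner product with all points of $C_2\setminus F$. A pure full-dimensional fan whose $(n-1)$-dimensional cones have rational normals has the *reverse search property* if, for every term order $\prec$, this is an orientation of its graph (each edge is directed in exactly one way) that has no directed cycle and has a unique sink (vertex without outgoing edges). **Theorem.** The Gröbner fan of every ideal $I\subseteq R$ is a pure full-dimensional fan whose $(n-1)$-dimensional cones have rational normals, and it has the reverse search property. Moreover, for every term order $\prec$, the cone $C_\prec(I)$ is a maximal cone of the Gröbner fan, and it is the unique sink of the orientation induced by $\prec$. -/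

import Mathlib

namespace GFan

noncomputable section

/-! ### Polyhedral geometry in `ℝⁿ` -/

/-- A polyhedron: `{x | A x ≤ b}` for a real matrix `A` and a real vector `b`. -/
def IsPolyhedron {n : ℕ} (P : Set (Fin n → ℝ)) : Prop :=
  ∃ (r : ℕ) (A : Matrix (Fin r) (Fin n) ℝ) (b : Fin r → ℝ), P = {x | A.mulVec x ≤ b}

/-- A polyhedral cone: `{x | A x ≤ 0}` for a real matrix `A`. -/
def IsPolyhedralCone {n : ℕ} (P : Set (Fin n → ℝ)) : Prop :=
  ∃ (r : ℕ) (A : Matrix (Fin r) (Fin n) ℝ), P = {x | A.mulVec x ≤ 0}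

/-- The set of points of `P` at which the linear form `⟨ω, ·⟩` attains its maximum over `P`. -/
def faceMaximizing {n : ℕ} (ω : Fin n → ℝ) (P : Set (Fin n → ℝ)) : Set (Fin n → ℝ) :=
  {x | x ∈ P ∧ ∀ y ∈ P, ω ⬝ᵥ y ≤ ω ⬝ᵥ x}

/-- A face of `P`: the empty set, or a non-empty set of maximizers of a linear form over `P`. -/
def IsFace {n : ℕ} (F P : Set (Fin n → ℝ)) : Prop :=
  F = ∅ ∨ (F.Nonempty ∧ ∃ ω : Fin n → ℝ, F = faceMaximizing ω P)

/-- The dimension of the smallest affine subspace containing `P` (for non-empty `P`). -/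
def dim {n : ℕ} (P : Set (Fin n → ℝ)) : ℕ :=
  Module.finrank ℝ (affineSpan ℝ P).direction

/-- A facet of `P`: a non-empty face whose dimension is one smaller than that of `P`. -/
def IsFacet {n : ℕ} (F P : Set (Fin n → ℝ)) : Prop :=
  F.Nonempty ∧ IsFace F P ∧ dim F + 1 = dim P

/-- A polyhedral complex: a collection of polyhedra that contains the non-empty faces of its
members and in which any two members intersect in a common face. -/
structure IsPolyhedralComplex {n : ℕ} (𝓕 : Set (Set (Fin n → ℝ))) : Prop where
  polyhedron : ∀ P ∈ 𝓕, IsPolyhedron P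
  face_mem : ∀ P ∈ 𝓕, ∀ F, F.Nonempty → IsFace F P → F ∈ 𝓕
  inter_face : ∀ A ∈ 𝓕, ∀ B ∈ 𝓕, IsFace (A ∩ B) A ∧ IsFace (A ∩ B) B

/-- A fan: a polyhedral complex consisting of cones. -/
structure IsFan {n : ℕ} (𝓕 : Set (Set (Fin n → ℝ))) : Prop where
  complex : IsPolyhedralComplex 𝓕
  cone : ∀ C ∈ 𝓕, IsPolyhedralCone C

/-- The maximal cones of `𝓕`, with respect to inclusion. -/
abbrev MaximalCone {n : ℕ} (𝓕 : Set (Set (Fin n → ℝ))) : Type :=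
  {C : Set (Fin n → ℝ) // Maximal (fun D => D ∈ 𝓕) C}

/-- The fan is pure and full-dimensional: all its maximal cones have dimension `n`. -/
def IsPureFullDimensional {n : ℕ} (𝓕 : Set (Set (Fin n → ℝ))) : Prop :=
  ∀ C : MaximalCone 𝓕, dim C.1 = n

/-- Every `(n-1)`-dimensional cone of the fan has a rational normal. -/
def HasRationalNormals {n : ℕ} (𝓕 : Set (Set (Fin n → ℝ))) : Prop :=
  ∀ F ∈ 𝓕, dim F + 1 = n →
    ∃ a : Fin n → ℚ, a ≠ 0 ∧ ∀ x ∈ F, x ⬝ᵥ (fun i => (a i : ℝ)) = 0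

/-! ### The graph of a fan, its orientation by a term order, the reverse search property -/

/-- The graph of a fan: its vertices are the maximal cones, and two distinct maximal cones are
adjacent if they share a common facet. -/
def fanGraph {n : ℕ} (𝓕 : Set (Set (Fin n → ℝ))) : SimpleGraph (MaximalCone 𝓕) where
  Adj C D := C ≠ D ∧ ∃ F, IsFacet F C.1 ∧ IsFacet F D.1
  symm := ⟨fun _ _ h => ⟨h.1.symm, h.2.imp fun _ hF => hF.symm⟩⟩
  loopless := ⟨fun _ h => h.1 rfl⟩

/-- `q - p` (with `p, q ∈ ℕⁿ`) is a non-zero normal of the common facet `F` of `C` and `D`, and it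
points from `C` to `D`: it has negative inner product with all points of `C \ F` and positive
inner product with all points of `D \ F`. -/
structure IsNormalFromTo {n : ℕ} (F C D : Set (Fin n → ℝ)) (p q : Fin n →₀ ℕ) : Prop where
  ne : q ≠ p
  zero : ∀ x ∈ F, x ⬝ᵥ (fun i => (q i : ℝ) - (p i : ℝ)) = 0
  neg : ∀ x ∈ C \ F, x ⬝ᵥ (fun i => (q i : ℝ) - (p i : ℝ)) < 0
  pos : ∀ x ∈ D \ F, 0 < x ⬝ᵥ (fun i => (q i : ℝ) - (p i : ℝ))

/-- The edge between `C` and `D` is directed from `C` to `D` by the term order `m`: it has a facet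
normal `q - p` pointing from `C` to `D` with `x^p` smaller than `x^q`. -/
def Directed {n : ℕ} (m : MonomialOrder (Fin n)) (𝓕 : Set (Set (Fin n → ℝ)))
    (C D : MaximalCone 𝓕) : Prop :=
  (fanGraph 𝓕).Adj C D ∧
    ∃ F, IsFacet F C.1 ∧ IsFacet F D.1 ∧
      ∃ p q : Fin n →₀ ℕ, IsNormalFromTo F C.1 D.1 p q ∧ m.toSyn p < m.toSyn q

/-- `r` orients `G`: it relates only adjacent vertices, and it relates any two adjacent vertices
in exactly one of the two directions. -/
structure IsOrientationOf {V : Type*} (G : SimpleGraph V) (r : V → V → Prop) : Prop where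
  adj : ∀ v w, r v w → G.Adj v w
  xor : ∀ v w, G.Adj v w → Xor (r v w) (r w v)

/-- There is no directed cycle. -/
def IsAcyclicRel {V : Type*} (r : V → V → Prop) : Prop :=
  ∀ v, ¬ Relation.TransGen r v v

/-- A sink: a vertex without outgoing edges. -/
def IsSink {V : Type*} (r : V → V → Prop) (v : V) : Prop :=
  ∀ w, ¬ r v w

/-- The reverse search property: `𝓕` is a pure full-dimensional fan (whose `(n-1)`-dimensional
cones have rational normals), and every term order induces an acyclic orientation of its graph
with a unique sink. -/
structure HasReverseSearchProperty {n : ℕ} (𝓕 : Set (Set (Fin n → ℝ))) : Prop where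
  fan : IsFan 𝓕
  pure : IsPureFullDimensional 𝓕
  rational : HasRationalNormals 𝓕
  orientation : ∀ m : MonomialOrder.{0, 0} (Fin n), IsOrientationOf (fanGraph 𝓕) (Directed m 𝓕)
  acyclic : ∀ m : MonomialOrder.{0, 0} (Fin n), IsAcyclicRel (Directed m 𝓕)
  unique_sink : ∀ m : MonomialOrder.{0, 0} (Fin n), ∃! C, IsSink (Directed m 𝓕) C

/-! ### Initial ideals and the Gröbner fan -/

/-- The `ω`-degree `⟨ω, d⟩` of the monomial with exponent vector `d`. -/
def weight {n : ℕ} (ω : Fin n → ℝ) (d : Fin n →₀ ℕ) : ℝ :=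
  ω ⬝ᵥ (fun i => (d i : ℝ))

open Classical in
/-- The initial form `in_ω(f)`: the sum of the terms of `f` of maximal `ω`-degree. -/
def initialForm {n : ℕ} {k : Type*} [Field k] (ω : Fin n → ℝ) (f : MvPolynomial (Fin n) k) :
    MvPolynomial (Fin n) k :=
  ∑ d ∈ f.support with ∀ e ∈ f.support, weight ω e ≤ weight ω d,
    MvPolynomial.monomial d (f.coeff d)

/-- The initial ideal `in_ω(I)` with respect to a vector `ω ∈ ℝⁿ`. -/
def initialIdeal {n : ℕ} {k : Type*} [Field k] (ω : Fin n → ℝ)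
    (I : Ideal (MvPolynomial (Fin n) k)) : Ideal (MvPolynomial (Fin n) k) :=
  Ideal.span (initialForm ω '' {f | f ∈ I})

/-- The initial ideal `in_≺(I)` with respect to a term order. -/
def termInitialIdeal {n : ℕ} {k : Type*} [Field k] (m : MonomialOrder (Fin n))
    (I : Ideal (MvPolynomial (Fin n) k)) : Ideal (MvPolynomial (Fin n) k) :=
  Ideal.span (m.leadingTerm '' {f | f ∈ I ∧ f ≠ 0})

/-- `C_v(I)`: the closure of the set of all `u ∈ ℝⁿ` with `in_u(I) = in_v(I)`. -/
def vectorCone {n : ℕ} {k : Type*} [Field k] (I : Ideal (MvPolynomial (Fin n) k))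
    (v : Fin n → ℝ) : Set (Fin n → ℝ) :=
  closure {u | initialIdeal u I = initialIdeal v I}

/-- `C_≺(I)`: the closure of the set of all `u ∈ ℝⁿ` with `in_u(I) = in_≺(I)`. -/
def termCone {n : ℕ} {k : Type*} [Field k] (I : Ideal (MvPolynomial (Fin n) k))
    (m : MonomialOrder (Fin n)) : Set (Fin n → ℝ) :=
  closure {u | initialIdeal u I = termInitialIdeal m I}

/-- The Gröbner fan of `I`: the closures of the equivalence classes (under equality of initial
ideals) that contain a vector with all coordinates positive, together with their non-empty
faces. -/
def groebnerFan {n : ℕ} {k : Type*} [Field k] (I : Ideal (MvPolynomial (Fin n) k)) :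
    Set (Set (Fin n → ℝ)) :=
  {C | ∃ v : Fin n → ℝ, (∀ i, 0 < v i) ∧
    (C = vectorCone I v ∨ (C.Nonempty ∧ IsFace C (vectorCone I v)))}

end

end GFan

/-! Fix a term order. Every monomial has a normal form modulo I, a combination of standard
monomials. Let the normal cone consist of all u for which no normal form has larger u-degree than
its monomial. For each u in this closed cone, boundary included, the parts of the normal forms that
keep the u-degree of the monomial are normal forms modulo in_u(I), with the same standard monomials
(`linExt_topNf_eq_zero_iff`). Hence in_u(I) is determined by which degree inequalities are
equalities at u (`initialIdeal_eq_iff`), and C_u(I) is the smallest face of the normal cone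
containing u (`vectorCone_eq`, `vectorCone_subset`). Finitely many inequalities suffice by Dickson's
lemma, and a Gordan-type argument gives a positive interior point; so the normal cone is C_≺(I)
(`termCone_eq`).

Every positive v lies in the normal cone of a term order refining the v-degree, so the Gröbner fan
consists of the faces of the normal cones (`mem_groebnerFan_iff`). Two such faces meet in a common
face because C_u(I) depends on u alone and not on the term order (`mem_of_add_mem_dualCone`).

Each facet has a difference of exponents as a normal, and a term order treats positively
proportional differences alike (`lt_of_expDiff_eq_smul`), so every edge gets one direction. Along a
directed edge, the smallest exponent at which the two sets of leading exponents differ belongs to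
the cone that is left (`lexLT_of_isNormalFromTo`); this relation is a strict order, so there is no
cycle. No edge leaves C_≺(I). From any other maximal cone, a generic ray whose direction is interior
to C_≺(I) and represents ≺ on the relevant exponents exits through a facet, and the corresponding
edge is outgoing (`exists_directed`). -/

open Filter Topology

/-! ### Polyhedral cones and their faces -/

namespace GFan

variable {n : ℕ}

/-- The polyhedral cone cut out by the inequalities `0 ≤ ⟨x, a⟩` for `a ∈ S`. -/
def dualCone (S : Finset (Fin n → ℝ)) : Set (Fin n → ℝ) :=
  {x | ∀ a ∈ S, 0 ≤ x ⬝ᵥ a}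

/-- `F` is an extreme subcone of `C`. -/
structure IsExtreme (F C : Set (Fin n → ℝ)) : Prop where
  sub : F ⊆ C
  zero : 0 ∈ F
  add : ∀ x ∈ F, ∀ y ∈ F, x + y ∈ F
  smul : ∀ t : ℝ, 0 ≤ t → ∀ x ∈ F, t • x ∈ F
  ext : ∀ x ∈ C, ∀ y ∈ C, x + y ∈ F → x ∈ F

theorem dualCone_zero (S : Finset (Fin n → ℝ)) : (0 : Fin n → ℝ) ∈ dualCone S := by
  intro a _; simp

theorem dualCone_add {S : Finset (Fin n → ℝ)} {x y : Fin n → ℝ} (hx : x ∈ dualCone S)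
    (hy : y ∈ dualCone S) : x + y ∈ dualCone S := by
  intro a ha
  rw [add_dotProduct]
  exact add_nonneg (hx a ha) (hy a ha)

theorem dualCone_smul {S : Finset (Fin n → ℝ)} {t : ℝ} (ht : 0 ≤ t) {x : Fin n → ℝ}
    (hx : x ∈ dualCone S) : t • x ∈ dualCone S := by
  intro a ha
  rw [smul_dotProduct]
  exact mul_nonneg ht (hx a ha)

theorem isExtreme_self (S : Finset (Fin n → ℝ)) : IsExtreme (dualCone S) (dualCone S) :=
  ⟨subset_rfl, dualCone_zero S, fun _ hx _ hy => dualCone_add hx hy,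
    fun _ ht _ hx => dualCone_smul ht hx, fun _ hx _ _ _ => hx⟩

theorem IsExtreme.trans {F G C : Set (Fin n → ℝ)} (h : IsExtreme F G) (h' : IsExtreme G C) :
    IsExtreme F C :=
  ⟨h.sub.trans h'.sub, h.zero, h.add, h.smul, fun x hx y hy hxy =>
    h.ext x (h'.ext x hx y hy (h.sub hxy)) y (h'.ext y hy x hx (by rw [add_comm]; exact h.sub hxy))
      hxy⟩

theorem IsExtreme.of_subset {F G C : Set (Fin n → ℝ)} (h : IsExtreme F C) (hFG : F ⊆ G)
    (hGC : G ⊆ C) : IsExtreme F G :=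
  ⟨hFG, h.zero, h.add, h.smul, fun x hx y hy hxy => h.ext x (hGC hx) y (hGC hy) hxy⟩

theorem isPolyhedralCone_dualCone (S : Finset (Fin n → ℝ)) : IsPolyhedralCone (dualCone S) := by
  refine ⟨S.card, fun i => -(S.equivFin.symm i : Fin n → ℝ), ?_⟩
  ext x
  constructor
  · intro hx i
    have := hx _ (S.equivFin.symm i).2
    simp only [Matrix.mulVec, neg_dotProduct, Pi.zero_apply]
    rw [dotProduct_comm] at this
    linarith
  · intro hx a ha
    have := hx (S.equivFin ⟨a, ha⟩)
    simp only [Matrix.mulVec, neg_dotProduct, Pi.zero_apply, Equiv.symm_apply_apply] at this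
    rw [dotProduct_comm]
    linarith

theorem IsPolyhedralCone.isPolyhedron {P : Set (Fin n → ℝ)} (h : IsPolyhedralCone P) :
    IsPolyhedron P := by
  obtain ⟨r, A, rfl⟩ := h
  exact ⟨r, A, 0, rfl⟩

/-- Inequalities strict at w survive a small step by continuity; only those that are equalities at w
constrain the direction y. -/
theorem eventually_mem_dualCone {S : Finset (Fin n → ℝ)} {w y : Fin n → ℝ}
    (hw : w ∈ dualCone S) (hy : ∀ a ∈ S, w ⬝ᵥ a = 0 → 0 ≤ y ⬝ᵥ a) :
    ∀ᶠ t in 𝓝[>] (0 : ℝ), w + t • y ∈ dualCone S := by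
  simp only [dualCone, Set.mem_ofPred_eq]
  rw [Filter.eventually_all_finset]
  intro a ha
  rcases (hw a ha).eq_or_lt with h | h
  · filter_upwards [self_mem_nhdsWithin] with t ht
    rw [add_dotProduct, smul_dotProduct, ← h, zero_add]
    exact mul_nonneg (le_of_lt ht) (hy a ha h.symm)
  · have hc : Tendsto (fun t : ℝ => w ⬝ᵥ a + t * (y ⬝ᵥ a)) (𝓝[>] 0) (𝓝 (w ⬝ᵥ a + 0 * (y ⬝ᵥ a))) :=
      Tendsto.mono_left (Continuous.tendsto (by fun_prop) 0) nhdsWithin_le_nhds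
    rw [zero_mul, add_zero] at hc
    filter_upwards [hc.eventually (lt_mem_nhds h)] with t ht
    rw [add_dotProduct, smul_dotProduct]
    exact le_of_lt ht

/-- A point of `F` at which only those inequalities are equalities that are so on all of `F`. -/
theorem exists_relint {S : Finset (Fin n → ℝ)} {F : Set (Fin n → ℝ)} (hF : F ⊆ dualCone S)
    (h0 : 0 ∈ F) (hadd : ∀ x ∈ F, ∀ y ∈ F, x + y ∈ F) :
    ∃ w ∈ F, ∀ a ∈ S, w ⬝ᵥ a = 0 → ∀ y ∈ F, y ⬝ᵥ a = 0 := by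
  classical
  have hch : ∀ a : Fin n → ℝ, ∃ x ∈ F, x ⬝ᵥ a = 0 → ∀ y ∈ F, y ⬝ᵥ a = 0 := by
    intro a
    by_cases h : ∀ y ∈ F, y ⬝ᵥ a = 0
    · exact ⟨0, h0, fun _ => h⟩
    · push Not at h
      obtain ⟨y, hy, hya⟩ := h
      exact ⟨y, hy, fun h => absurd h hya⟩
  choose x hxF hx using hch
  refine ⟨∑ a ∈ S, x a, ?_, ?_⟩
  · exact Finset.sum_induction _ (· ∈ F) (fun a b ha hb => hadd a ha b hb) h0 fun a _ => hxF a
  · intro a ha h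
    rw [sum_dotProduct, Finset.sum_eq_zero_iff_of_nonneg fun b _ => hF (hxF b) a ha] at h
    exact hx a (h a ha)

theorem exists_sub_smul_mem {S : Finset (Fin n → ℝ)} {w y : Fin n → ℝ} (hw : w ∈ dualCone S)
    (hy : ∀ a ∈ S, w ⬝ᵥ a = 0 → y ⬝ᵥ a = 0) : ∃ t : ℝ, 0 < t ∧ w - t • y ∈ dualCone S := by
  have h := eventually_mem_dualCone (y := -y) hw fun a ha h => by simp [hy a ha h]
  obtain ⟨t, ht, ht'⟩ := (h.and self_mem_nhdsWithin).exists
  refine ⟨t, ht', ?_⟩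
  rw [sub_eq_add_neg, ← smul_neg]
  exact ht

/-- For small t > 0 the point w - t • y is still in the cone, so w = t • y + (w - t • y) is a
decomposition inside the cone, and extremality puts t • y into F. -/
theorem IsExtreme.mem_of_relint {S : Finset (Fin n → ℝ)} {F : Set (Fin n → ℝ)}
    (hF : IsExtreme F (dualCone S)) {w y : Fin n → ℝ} (hw : w ∈ F) (hy : y ∈ dualCone S)
    (h : ∀ a ∈ S, w ⬝ᵥ a = 0 → y ⬝ᵥ a = 0) : y ∈ F := by
  obtain ⟨t, ht, hm⟩ := exists_sub_smul_mem (hF.sub hw) h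
  have h1 : t • y ∈ F := hF.ext _ (dualCone_smul ht.le hy) _ hm (by simpa using hw)
  have h2 := hF.smul t⁻¹ (inv_nonneg.2 ht.le) _ h1
  rwa [smul_smul, inv_mul_cancel₀ ht.ne', one_smul] at h2

theorem isExtreme_iff_isFace {S : Finset (Fin n → ℝ)} {F : Set (Fin n → ℝ)} :
    IsExtreme F (dualCone S) ↔ F.Nonempty ∧ IsFace F (dualCone S) := by
  classical
  constructor
  · intro hF
    -- The exposing form is minus the sum of all inequalities that vanish on F: it is nonpositive on
    -- the cone, and zero only where each of them vanishes.
    refine ⟨⟨0, hF.zero⟩, Or.inr ⟨⟨0, hF.zero⟩, -∑ a ∈ S with ∀ y ∈ F, y ⬝ᵥ a = 0, a, ?_⟩⟩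
    obtain ⟨w, hwF, hw⟩ := exists_relint hF.sub hF.zero hF.add
    have key : ∀ x, (-∑ a ∈ S with ∀ y ∈ F, y ⬝ᵥ a = 0, a) ⬝ᵥ x =
        -∑ a ∈ S with ∀ y ∈ F, y ⬝ᵥ a = 0, x ⬝ᵥ a := by
      intro x
      rw [neg_dotProduct, sum_dotProduct]
      simp_rw [dotProduct_comm _ x]
    have hnn : ∀ y ∈ dualCone S, 0 ≤ ∑ a ∈ S with ∀ y ∈ F, y ⬝ᵥ a = 0, y ⬝ᵥ a :=
      fun y hy => Finset.sum_nonneg fun a ha => hy a (Finset.mem_filter.1 ha).1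
    ext x
    simp only [faceMaximizing, Set.mem_ofPred_eq, key]
    constructor
    · intro hx
      refine ⟨hF.sub hx, fun y hy => ?_⟩
      have : ∑ a ∈ S with ∀ y ∈ F, y ⬝ᵥ a = 0, x ⬝ᵥ a = 0 :=
        Finset.sum_eq_zero fun a ha => (Finset.mem_filter.1 ha).2 x hx
      have := hnn y hy
      linarith
    · rintro ⟨hx, hmax⟩
      have h0 := hmax 0 (dualCone_zero S)
      simp only [zero_dotProduct, Finset.sum_const_zero, neg_zero] at h0
      have h1 := le_antisymm (by linarith) (hnn x hx)
      rw [Finset.sum_eq_zero_iff_of_nonneg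
        fun a ha => hx a (Finset.mem_filter.1 ha).1] at h1
      exact hF.mem_of_relint hwF hx fun a ha h =>
        h1 a (Finset.mem_filter.2 ⟨ha, hw a ha h⟩)
  · rintro ⟨hne, h | ⟨-, ω, rfl⟩⟩
    · simp [h] at hne
    obtain ⟨x₀, hx₀, hmax⟩ := hne
    have h0 : ω ⬝ᵥ x₀ = 0 := by
      have h1 := hmax 0 (dualCone_zero S)
      have h2 := hmax _ (dualCone_smul (zero_le_two) hx₀)
      simp only [dotProduct_zero, dotProduct_smul, smul_eq_mul] at h1 h2
      linarith
    have hle : ∀ y ∈ dualCone S, ω ⬝ᵥ y ≤ 0 := fun y hy => h0 ▸ hmax y hy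
    have hiff : ∀ x, x ∈ faceMaximizing ω (dualCone S) ↔ x ∈ dualCone S ∧ ω ⬝ᵥ x = 0 := by
      intro x
      refine ⟨fun hx => ⟨hx.1, le_antisymm (hle x hx.1) (h0 ▸ hx.2 x₀ hx₀)⟩,
        fun hx => ⟨hx.1, fun y hy => ?_⟩⟩
      rw [hx.2]
      exact hle y hy
    refine ⟨fun x hx => hx.1, ?_, ?_, ?_, ?_⟩
    · rw [hiff]
      exact ⟨dualCone_zero S, by simp⟩
    · intro x hx y hy
      rw [hiff] at hx hy ⊢
      exact ⟨dualCone_add hx.1 hy.1, by rw [dotProduct_add, hx.2, hy.2, add_zero]⟩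
    · intro t ht x hx
      rw [hiff] at hx ⊢
      exact ⟨dualCone_smul ht hx.1, by rw [dotProduct_smul, hx.2, smul_zero]⟩
    · intro x hx y hy hxy
      rw [hiff] at hxy ⊢
      rw [dotProduct_add] at hxy
      exact ⟨hx, le_antisymm (hle x hx) (by linarith [hle y hy, hxy.2])⟩

/-- An extreme subcone of a polyhedral cone is a polyhedral cone. -/
theorem IsExtreme.exists_eq_dualCone {S : Finset (Fin n → ℝ)} {F : Set (Fin n → ℝ)}
    (hF : IsExtreme F (dualCone S)) : ∃ T : Finset (Fin n → ℝ), F = dualCone T := by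
  classical
  refine ⟨S ∪ ({a ∈ S | ∀ y ∈ F, y ⬝ᵥ a = 0}).image Neg.neg, ?_⟩
  obtain ⟨w, hwF, hw⟩ := exists_relint hF.sub hF.zero hF.add
  ext x
  constructor
  · intro hx a ha
    rcases Finset.mem_union.1 ha with ha | ha
    · exact hF.sub hx a ha
    · obtain ⟨b, hb, rfl⟩ := Finset.mem_image.1 ha
      rw [dotProduct_neg, (Finset.mem_filter.1 hb).2 x hx, neg_zero]
  · intro hx
    have hxS : x ∈ dualCone S := fun a ha => hx a (Finset.mem_union_left _ ha)
    refine hF.mem_of_relint hwF hxS fun a ha h => le_antisymm ?_ (hxS a ha)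
    have := hx (-a) (Finset.mem_union_right _ (Finset.mem_image_of_mem _
      (Finset.mem_filter.2 ⟨ha, hw a ha h⟩)))
    rw [dotProduct_neg] at this
    linarith

theorem dim_eq_finrank_span {F : Set (Fin n → ℝ)} (h0 : 0 ∈ F) :
    dim F = Module.finrank ℝ (Submodule.span ℝ F) := by
  have h : (fun x : Fin n → ℝ => x -ᵥ 0) '' F = F := by
    ext x
    constructor
    · rintro ⟨y, hy, rfl⟩
      change y - 0 ∈ F
      rwa [sub_zero]
    · exact fun hx => ⟨x, hx, sub_zero x⟩
  rw [dim, direction_affineSpan, vectorSpan_eq_span_vsub_set_right ℝ h0, h]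

theorem span_dualCone_eq_top {S : Finset (Fin n → ℝ)} {c : Fin n → ℝ}
    (hc : ∀ a ∈ S, 0 < c ⬝ᵥ a) : Submodule.span ℝ (dualCone S) = ⊤ := by
  have hcS : c ∈ dualCone S := fun a ha => (hc a ha).le
  rw [eq_top_iff]
  intro z _
  obtain ⟨t, ht, ht'⟩ := ((eventually_mem_dualCone (y := z) hcS
    fun a ha h => absurd h (hc a ha).ne').and self_mem_nhdsWithin).exists
  have h1 : t • z ∈ Submodule.span ℝ (dualCone S) := by
    have := Submodule.sub_mem _ (Submodule.subset_span (R := ℝ) ht)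
      (Submodule.subset_span (R := ℝ) hcS)
    simpa using this
  have h2 := Submodule.smul_mem _ t⁻¹ h1
  rwa [smul_smul, inv_mul_cancel₀ (ne_of_gt ht'), one_smul] at h2

theorem dim_dualCone {S : Finset (Fin n → ℝ)} {c : Fin n → ℝ}
    (hc : ∀ a ∈ S, 0 < c ⬝ᵥ a) : dim (dualCone S) = n := by
  rw [dim_eq_finrank_span (dualCone_zero S), span_dualCone_eq_top hc]
  simp

/-- An extreme subcone that contains an interior point is the whole cone. -/
theorem IsExtreme.eq_of_interior {S T : Finset (Fin n → ℝ)}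
    (h : IsExtreme (dualCone T) (dualCone S)) {c : Fin n → ℝ}
    (hc : ∀ a ∈ T, 0 < c ⬝ᵥ a) : dualCone T = dualCone S := by
  refine h.sub.antisymm fun y hy => ?_
  have hcT : c ∈ dualCone T := fun a ha => (hc a ha).le
  obtain ⟨t, ht, hm⟩ := exists_sub_smul_mem (y := y) hcT fun a ha h => absurd h (hc a ha).ne'
  have h1 := h.ext (t • y) (dualCone_smul ht.le hy) (c - t • y) (h.sub hm) (by simpa using hcT)
  have h2 := dualCone_smul (inv_nonneg.2 ht.le) h1
  rwa [smul_smul, inv_mul_cancel₀ ht.ne', one_smul] at h2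

end GFan

namespace GFan

open MvPolynomial

variable {n : ℕ} {k : Type*} [Field k]

/-! ### Weights and homogeneous parts -/

theorem weight_add (u : Fin n → ℝ) (a b : Fin n →₀ ℕ) :
    weight u (a + b) = weight u a + weight u b := by
  simp [weight, dotProduct, mul_add, Finset.sum_add_distrib]

theorem weight_zero (u : Fin n → ℝ) : weight u 0 = 0 := by
  simp [weight, dotProduct]

/-- The real vector `b - a` of a pair of exponents. -/
def expDiff (a b : Fin n →₀ ℕ) : Fin n → ℝ := fun i => (b i : ℝ) - (a i : ℝ)

theorem dotProduct_expDiff (u : Fin n → ℝ) (a b : Fin n →₀ ℕ) :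
    u ⬝ᵥ expDiff a b = weight u b - weight u a := by
  simp [weight, dotProduct, mul_sub, Finset.sum_sub_distrib, expDiff]

theorem expDiff_ne_zero {a b : Fin n →₀ ℕ} (h : a ≠ b) : expDiff a b ≠ 0 := by
  intro h0
  apply h
  ext i
  have := congrFun h0 i
  simp only [expDiff, Pi.zero_apply, sub_eq_zero, Nat.cast_inj] at this
  exact this.symm

theorem weight_add_left (u v : Fin n → ℝ) (a : Fin n →₀ ℕ) :
    weight (u + v) a = weight u a + weight v a := by
  simp [weight, add_dotProduct]

theorem weight_smul_left (t : ℝ) (u : Fin n → ℝ) (a : Fin n →₀ ℕ) :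
    weight (t • u) a = t * weight u a := by
  simp [weight, smul_dotProduct]

theorem continuous_weight (a : Fin n →₀ ℕ) : Continuous fun u : Fin n → ℝ => weight u a := by
  unfold weight dotProduct
  fun_prop

theorem weight_pos {u : Fin n → ℝ} (hu : ∀ i, 0 < u i) {a : Fin n →₀ ℕ} (ha : a ≠ 0) :
    0 < weight u a := by
  obtain ⟨i, hi⟩ := Finsupp.ne_iff.1 ha
  unfold weight dotProduct
  refine Finset.sum_pos' (fun i _ => mul_nonneg (hu i).le (Nat.cast_nonneg _))
    ⟨i, Finset.mem_univ _, mul_pos (hu i) ?_⟩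
  exact Nat.cast_pos.2 (Nat.pos_of_ne_zero hi)

open Classical in
/-- The part of `p` of `u`-degree `d`. -/
noncomputable def weightPart (u : Fin n → ℝ) (d : ℝ) (p : MvPolynomial (Fin n) k) : MvPolynomial (Fin n) k :=
  ∑ e ∈ p.support with weight u e = d, monomial e (p.coeff e)

open Classical in
theorem coeff_weightPart (u : Fin n → ℝ) (d : ℝ) (p : MvPolynomial (Fin n) k)
    (e : Fin n →₀ ℕ) : (weightPart u d p).coeff e = if weight u e = d then p.coeff e else 0 := by
  rw [weightPart, coeff_sum]
  simp only [coeff_monomial]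
  rw [Finset.sum_ite_eq']
  simp only [Finset.mem_filter, mem_support_iff]
  split_ifs <;> simp_all

open Classical in
theorem coeff_initialForm (u : Fin n → ℝ) (p : MvPolynomial (Fin n) k) (e : Fin n →₀ ℕ) :
    (initialForm u p).coeff e =
      if ∀ b ∈ p.support, weight u b ≤ weight u e then p.coeff e else 0 := by
  rw [initialForm, coeff_sum]
  simp only [coeff_monomial]
  rw [Finset.sum_ite_eq']
  simp only [Finset.mem_filter]
  by_cases h : e ∈ p.support
  · simp [h]
  · simp [h, notMem_support_iff.1 h]

theorem initialForm_eq_weightPart {u : Fin n → ℝ} {p : MvPolynomial (Fin n) k} {d : ℝ}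
    (hle : ∀ e ∈ p.support, weight u e ≤ d) (h : ∃ e ∈ p.support, weight u e = d) :
    initialForm u p = weightPart u d p := by
  classical
  obtain ⟨e₀, he₀, rfl⟩ := h
  ext e
  rw [coeff_initialForm, coeff_weightPart]
  by_cases he : e ∈ p.support
  · refine if_congr ⟨fun h => (hle e he).antisymm (h e₀ he₀), fun h b hb => ?_⟩ rfl rfl
    rw [h]
    exact hle b hb
  · rw [notMem_support_iff.1 he]
    simp

theorem exists_initialForm_eq_weightPart (u : Fin n → ℝ) {p : MvPolynomial (Fin n) k}
    (hp : p ≠ 0) : ∃ d, (∀ e ∈ p.support, weight u e ≤ d) ∧ (∃ e ∈ p.support, weight u e = d) ∧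
      initialForm u p = weightPart u d p := by
  obtain ⟨e, he, hmax⟩ := Finset.exists_max_image p.support (weight u) (support_nonempty.2 hp)
  exact ⟨weight u e, hmax, ⟨e, he, rfl⟩, initialForm_eq_weightPart hmax ⟨e, he, rfl⟩⟩

theorem initialForm_zero (u : Fin n → ℝ) : initialForm u (0 : MvPolynomial (Fin n) k) = 0 := by
  simp [initialForm]

theorem initialForm_ne_zero (u : Fin n → ℝ) {p : MvPolynomial (Fin n) k} (hp : p ≠ 0) :
    initialForm u p ≠ 0 := by
  classical
  obtain ⟨d, -, ⟨e, he, hd⟩, h⟩ := exists_initialForm_eq_weightPart u hp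
  rw [h]
  intro h0
  have := coeff_weightPart u d p e
  rw [h0, if_pos hd, coeff_zero] at this
  exact mem_support_iff.1 he this.symm

theorem monomial_mul_weightPart (u : Fin n → ℝ) (d : ℝ) (p : MvPolynomial (Fin n) k)
    (s : Fin n →₀ ℕ) (c : k) :
    monomial s c * weightPart u d p = weightPart u (weight u s + d) (monomial s c * p) := by
  classical
  ext e
  rw [coeff_weightPart, coeff_monomial_mul', coeff_monomial_mul']
  by_cases hs : s ≤ e
  · rw [if_pos hs, if_pos hs, coeff_weightPart]
    have : weight u e = weight u s + weight u (e - s) := by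
      rw [← weight_add, add_tsub_cancel_of_le hs]
    rw [this]
    simp only [add_right_inj]
    split_ifs <;> simp
  · simp [hs]

theorem weight_le_of_mem_support_monomial_mul {u : Fin n → ℝ} {d : ℝ}
    {p : MvPolynomial (Fin n) k} (h : ∀ e ∈ p.support, weight u e ≤ d) (s : Fin n →₀ ℕ) (c : k) :
    ∀ e ∈ (monomial s c * p).support, weight u e ≤ weight u s + d := by
  intro e he
  rw [mem_support_iff, coeff_monomial_mul'] at he
  by_cases hs : s ≤ e
  · rw [if_pos hs] at he
    have := h (e - s) (mem_support_iff.2 (right_ne_zero_of_mul he))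
    rw [← add_tsub_cancel_of_le hs, weight_add]
    linarith
  · simp [hs] at he

/-! ### Linear maps given by their values on monomials -/

/-- The linear map sending the monomial with exponent `b` to `φ b`. -/
noncomputable def linExt (φ : (Fin n →₀ ℕ) → MvPolynomial (Fin n) k) :
    MvPolynomial (Fin n) k →ₗ[k] MvPolynomial (Fin n) k :=
  (basisMonomials (Fin n) k).constr k φ

theorem linExt_monomial (φ : (Fin n →₀ ℕ) → MvPolynomial (Fin n) k) (b : Fin n →₀ ℕ) (c : k) :
    linExt φ (monomial b c) = c • φ b := by
  have h : linExt φ (monomial b 1) = φ b := by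
    have := (basisMonomials (Fin n) k).constr_basis k φ b
    rwa [coe_basisMonomials] at this
  rw [← h, ← map_smul, smul_monomial, smul_eq_mul, mul_one]

theorem linExt_apply (φ : (Fin n →₀ ℕ) → MvPolynomial (Fin n) k) (p : MvPolynomial (Fin n) k) :
    linExt φ p = ∑ b ∈ p.support, p.coeff b • φ b := by
  conv_lhs => rw [p.as_sum]
  rw [map_sum]
  exact Finset.sum_congr rfl fun b _ => linExt_monomial φ b _

theorem coeff_linExt (φ : (Fin n →₀ ℕ) → MvPolynomial (Fin n) k) (p : MvPolynomial (Fin n) k)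
    {s : Finset (Fin n →₀ ℕ)} (hs : p.support ⊆ s) (e : Fin n →₀ ℕ) :
    (linExt φ p).coeff e = ∑ b ∈ s, p.coeff b * (φ b).coeff e := by
  rw [linExt_apply, coeff_sum]
  simp only [coeff_smul, smul_eq_mul]
  refine Finset.sum_subset hs fun b _ hb => ?_
  rw [notMem_support_iff.1 hb, zero_mul]

theorem exists_of_mem_support_linExt {φ : (Fin n →₀ ℕ) → MvPolynomial (Fin n) k}
    {p : MvPolynomial (Fin n) k} {e : Fin n →₀ ℕ} (he : e ∈ (linExt φ p).support) :
    ∃ b ∈ p.support, e ∈ (φ b).support := by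
  rw [mem_support_iff, coeff_linExt φ p subset_rfl] at he
  obtain ⟨b, hb, h⟩ := Finset.exists_ne_zero_of_sum_ne_zero he
  exact ⟨b, hb, mem_support_iff.2 (right_ne_zero_of_mul h)⟩

theorem sub_linExt_mem {φ : (Fin n →₀ ℕ) → MvPolynomial (Fin n) k}
    {J : Ideal (MvPolynomial (Fin n) k)} (h : ∀ b, monomial b 1 - φ b ∈ J)
    (p : MvPolynomial (Fin n) k) : p - linExt φ p ∈ J := by
  have : p - linExt φ p = ∑ b ∈ p.support, C (p.coeff b) * (monomial b 1 - φ b) := by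
    conv_lhs => rw [linExt_apply, p.as_sum]
    simp only [mul_sub, Finset.sum_sub_distrib, C_mul_monomial, mul_one, smul_eq_C_mul]
    rw [← p.as_sum]
  rw [this]
  exact J.sum_mem fun b _ => J.mul_mem_left _ (h b)

theorem linExt_eq_self {φ : (Fin n →₀ ℕ) → MvPolynomial (Fin n) k} {p : MvPolynomial (Fin n) k}
    (h : ∀ b ∈ p.support, φ b = monomial b 1) : linExt φ p = p := by
  conv_rhs => rw [p.as_sum]
  rw [linExt_apply]
  refine Finset.sum_congr rfl fun b hb => ?_
  rw [h b hb, smul_monomial, smul_eq_mul, mul_one]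

/-! ### Normal forms -/

/-- The exponents of the leading monomials of `I`. -/
def leadExps (m : MonomialOrder.{0, 0} (Fin n)) (I : Ideal (MvPolynomial (Fin n) k)) :
    Set (Fin n →₀ ℕ) :=
  {b | ∃ f ∈ I, f ≠ 0 ∧ m.degree f = b}

variable (m : MonomialOrder.{0, 0} (Fin n)) (I : Ideal (MvPolynomial (Fin n) k))

variable {I} in
theorem eq_zero_of_standard {p : MvPolynomial (Fin n) k} (hp : p ∈ I)
    (h : ∀ e ∈ p.support, e ∉ leadExps m I) : p = 0 := by
  by_contra h0
  exact h _ (m.degree_mem_support h0) ⟨p, hp, h0, rfl⟩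

/-- The division algorithm, as a well-founded induction on b: a leading monomial is congruent modulo
I to minus the rescaled tail of its polynomial, whose monomials are smaller. -/
theorem exists_normalForm (b : Fin n →₀ ℕ) : ∃ p : MvPolynomial (Fin n) k,
    monomial b 1 - p ∈ I ∧ ∀ e ∈ p.support, e ∉ leadExps m I ∧ m.toSyn e ≤ m.toSyn b := by
  classical
  induction hs : m.toSyn b using WellFoundedLT.induction generalizing b with
  | ind s ih =>
  subst hs
  by_cases hb : b ∈ leadExps m I
  · obtain ⟨f, hf, hf0, rfl⟩ := hb
    have hlt : ∀ e ∈ f.support.erase (m.degree f), m.toSyn e < m.toSyn (m.degree f) := by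
      intro e he
      refine lt_of_le_of_ne (m.le_degree (Finset.mem_of_mem_erase he)) fun h => ?_
      exact Finset.ne_of_mem_erase he (m.toSyn.injective h)
    have hch : ∀ e : Fin n →₀ ℕ, ∃ p : MvPolynomial (Fin n) k,
        e ∈ f.support.erase (m.degree f) → monomial e 1 - p ∈ I ∧
          ∀ e' ∈ p.support, e' ∉ leadExps m I ∧ m.toSyn e' ≤ m.toSyn e := by
      intro e
      by_cases he : e ∈ f.support.erase (m.degree f)
      · obtain ⟨p, hp⟩ := ih _ (hlt e he) e rfl
        exact ⟨p, fun _ => hp⟩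
      · exact ⟨0, fun h => absurd h he⟩
    choose P hP using hch
    have hc : f.coeff (m.degree f) ≠ 0 := mem_support_iff.1 (m.degree_mem_support hf0)
    set c := f.coeff (m.degree f) with hcdef
    refine ⟨-∑ e ∈ f.support.erase (m.degree f), C (c⁻¹ * f.coeff e) * P e, ?_, ?_⟩
    · have hsum : C c⁻¹ * f = monomial (m.degree f) 1 +
          ∑ e ∈ f.support.erase (m.degree f), C (c⁻¹ * f.coeff e) * monomial e 1 := by
        conv_lhs => rw [f.as_sum, ← Finset.add_sum_erase _ _ (m.degree_mem_support hf0)]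
        rw [mul_add, Finset.mul_sum]
        simp only [C_mul_monomial, mul_one]
        rw [← hcdef, inv_mul_cancel₀ hc]
      have : monomial (m.degree f) 1 - -∑ e ∈ f.support.erase (m.degree f),
          C (c⁻¹ * f.coeff e) * P e = C c⁻¹ * f - ∑ e ∈ f.support.erase (m.degree f),
          C (c⁻¹ * f.coeff e) * (monomial e 1 - P e) := by
        rw [hsum]
        simp only [mul_sub, Finset.sum_sub_distrib]
        ring
      rw [this]
      exact I.sub_mem (I.mul_mem_left _ hf) (I.sum_mem fun e he => I.mul_mem_left _ (hP e he).1)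
    · intro e he
      rw [support_neg] at he
      obtain ⟨b, hb, h⟩ := Finset.mem_biUnion.1 (support_sum he)
      have h' : e ∈ (P b).support := by
        rw [mem_support_iff, coeff_C_mul] at h
        exact mem_support_iff.2 (right_ne_zero_of_mul h)
      exact ⟨((hP b hb).2 e h').1, ((hP b hb).2 e h').2.trans (hlt b hb).le⟩
  · refine ⟨monomial b 1, by simp, fun e he => ?_⟩
    rw [support_monomial, if_neg one_ne_zero, Finset.mem_singleton] at he
    subst he
    exact ⟨hb, le_rfl⟩

/-- The normal form modulo `I` of the monomial with exponent `b`. -/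
noncomputable def nf (b : Fin n →₀ ℕ) : MvPolynomial (Fin n) k := (exists_normalForm m I b).choose

theorem sub_nf_mem (b : Fin n →₀ ℕ) : monomial b 1 - nf m I b ∈ I :=
  (exists_normalForm m I b).choose_spec.1

variable {m I}

theorem notMem_leadExps_of_mem_nf {b e : Fin n →₀ ℕ} (he : e ∈ (nf m I b).support) :
    e ∉ leadExps m I :=
  ((exists_normalForm m I b).choose_spec.2 e he).1

theorem le_of_mem_nf {b e : Fin n →₀ ℕ} (he : e ∈ (nf m I b).support) :
    m.toSyn e ≤ m.toSyn b :=
  ((exists_normalForm m I b).choose_spec.2 e he).2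

theorem lt_of_mem_nf {b e : Fin n →₀ ℕ} (hb : b ∈ leadExps m I) (he : e ∈ (nf m I b).support) :
    m.toSyn e < m.toSyn b := by
  refine lt_of_le_of_ne (le_of_mem_nf he) fun h => notMem_leadExps_of_mem_nf he ?_
  rwa [m.toSyn.injective h]

theorem nf_of_notMem {b : Fin n →₀ ℕ} (hb : b ∉ leadExps m I) : nf m I b = monomial b 1 := by
  classical
  symm
  rw [← sub_eq_zero]
  refine eq_zero_of_standard m (sub_nf_mem m I b) fun e he => ?_
  rcases Finset.mem_union.1 (support_sub _ _ _ he) with h | h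
  · rw [support_monomial, if_neg one_ne_zero, Finset.mem_singleton] at h
    rwa [h]
  · exact notMem_leadExps_of_mem_nf h

/-- Reduction to normal form changes a polynomial by an element of I, and no nonzero element of I is
a combination of standard monomials. -/
theorem linExt_nf_eq_zero_iff {p : MvPolynomial (Fin n) k} :
    linExt (nf m I) p = 0 ↔ p ∈ I := by
  have h := sub_linExt_mem (sub_nf_mem m I) p
  constructor
  · intro h0
    rwa [h0, sub_zero] at h
  · intro hp
    refine eq_zero_of_standard m ((I.sub_mem_iff_right hp).1 h) fun e he => ?_
    obtain ⟨b, -, hb⟩ := exists_of_mem_support_linExt he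
    exact notMem_leadExps_of_mem_nf hb

/-! ### The normal cone of a term order and the initial ideals of its vectors -/

variable (m I)

/-- The vectors `u` for which no normal form has larger `u`-degree than its monomial. -/
def normalCone : Set (Fin n → ℝ) :=
  {u | ∀ b, ∀ e ∈ (nf m I b).support, weight u e ≤ weight u b}

/-- The part of `nf m I b` that has the same `u`-degree as the monomial `b`. -/
noncomputable def topNf (u : Fin n → ℝ) (b : Fin n →₀ ℕ) : MvPolynomial (Fin n) k :=
  weightPart u (weight u b) (nf m I b)

variable {m I}

theorem topNf_of_notMem (u : Fin n → ℝ) {b : Fin n →₀ ℕ} (hb : b ∉ leadExps m I) :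
    topNf m I u b = monomial b 1 := by
  classical
  ext e
  rw [topNf, nf_of_notMem hb, coeff_weightPart, coeff_monomial]
  split_ifs <;> simp_all

theorem mem_nf_of_mem_topNf {u : Fin n → ℝ} {b e : Fin n →₀ ℕ}
    (h : e ∈ (topNf m I u b).support) : e ∈ (nf m I b).support ∧ weight u e = weight u b := by
  classical
  rw [mem_support_iff, topNf, coeff_weightPart] at h
  rw [mem_support_iff]
  split_ifs at h with h'
  · exact ⟨h, h'⟩
  · exact absurd rfl h

/-- In degree d this is the vanishing of the normal form of p: a monomial of degree below d cannot
contribute, as its normal form does not exceed its degree. -/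
theorem linExt_topNf_weightPart {u : Fin n → ℝ} (hu : u ∈ normalCone m I)
    {p : MvPolynomial (Fin n) k} (hp : p ∈ I) {d : ℝ} (hd : ∀ e ∈ p.support, weight u e ≤ d) :
    linExt (topNf m I u) (weightPart u d p) = 0 := by
  classical
  have hs : (weightPart u d p).support ⊆ p.support := by
    intro e he
    rw [mem_support_iff, coeff_weightPart] at he
    rw [mem_support_iff]
    split_ifs at he with h
    · exact he
    · exact absurd rfl he
  ext e
  rw [coeff_linExt _ _ hs, coeff_zero]
  by_cases he : weight u e = d
  · have h0 : (linExt (nf m I) p).coeff e = 0 := by rw [linExt_nf_eq_zero_iff.2 hp, coeff_zero]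
    rw [coeff_linExt _ _ subset_rfl] at h0
    rw [← h0]
    refine Finset.sum_congr rfl fun b hb => ?_
    rw [topNf, coeff_weightPart, coeff_weightPart]
    by_cases hbd : weight u b = d
    · rw [if_pos hbd, if_pos (he.trans hbd.symm)]
    · rw [if_neg hbd, zero_mul]
      have : e ∉ (nf m I b).support := fun h =>
        hbd ((hd b hb).antisymm (he ▸ hu b e h))
      rw [notMem_support_iff.1 this, mul_zero]
  · refine Finset.sum_eq_zero fun b _ => ?_
    rw [topNf, coeff_weightPart, coeff_weightPart]
    split_ifs with h1 h2
    · exact absurd (h2.trans h1) he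
    all_goals simp

theorem coeff_self_sub_nf {b : Fin n →₀ ℕ} (hb : b ∈ leadExps m I) :
    (monomial b 1 - nf m I b).coeff b = 1 := by
  classical
  have : b ∉ (nf m I b).support := fun h => notMem_leadExps_of_mem_nf h hb
  rw [coeff_sub, notMem_support_iff.1 this, coeff_monomial, if_pos rfl, sub_zero]

theorem mem_of_mem_support_sub_nf {b e : Fin n →₀ ℕ}
    (he : e ∈ (monomial b 1 - nf m I b).support) : e = b ∨ e ∈ (nf m I b).support := by
  classical
  rcases Finset.mem_union.1 (support_sub _ _ _ he) with h | h
  · rw [support_monomial, if_neg one_ne_zero, Finset.mem_singleton] at h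
    exact Or.inl h
  · exact Or.inr h

theorem weightPart_sub_nf (u : Fin n → ℝ) (b : Fin n →₀ ℕ) :
    weightPart u (weight u b) (monomial b 1 - nf m I b) = monomial b 1 - topNf m I u b := by
  classical
  ext e
  rw [coeff_weightPart, coeff_sub, coeff_sub, topNf, coeff_weightPart, coeff_monomial]
  by_cases hbe : b = e
  · subst hbe
    simp
  · rw [if_neg hbe]
    split_ifs <;> simp

theorem sub_topNf_mem {u : Fin n → ℝ} (hu : u ∈ normalCone m I) (b : Fin n →₀ ℕ) :
    monomial b 1 - topNf m I u b ∈ initialIdeal u I := by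
  by_cases hb : b ∈ leadExps m I
  · rw [← weightPart_sub_nf, ← initialForm_eq_weightPart]
    · exact Ideal.subset_span ⟨_, sub_nf_mem m I b, rfl⟩
    · intro e he
      rcases mem_of_mem_support_sub_nf he with rfl | h
      · exact le_rfl
      · exact hu b e h
    · exact ⟨b, by rw [mem_support_iff, coeff_self_sub_nf hb]; exact one_ne_zero, rfl⟩
  · rw [topNf_of_notMem u hb, sub_self]
    exact Ideal.zero_mem _

/-- The central fact: on the whole closed normal cone, the truncated normal forms compute reduction
modulo in_u(I), and the standard monomials stay those of m. -/
theorem linExt_topNf_eq_zero_iff {u : Fin n → ℝ} (hu : u ∈ normalCone m I)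
    {p : MvPolynomial (Fin n) k} : linExt (topNf m I u) p = 0 ↔ p ∈ initialIdeal u I := by
  constructor
  · intro h0
    have h := sub_linExt_mem (sub_topNf_mem hu) p
    rwa [h0, sub_zero] at h
  · intro hp
    -- The map is only linear, so the induction over the ideal span carries an arbitrary multiplier
    -- a.
    suffices h : ∀ a, linExt (topNf m I u) (a * p) = 0 by simpa using h 1
    refine Submodule.span_induction (p := fun x _ => ∀ a, linExt (topNf m I u) (a * x) = 0)
      ?_ ?_ ?_ ?_ hp
    · rintro _ ⟨f, hf, rfl⟩ a
      by_cases hf0 : f = 0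
      · rw [hf0, initialForm_zero, mul_zero, map_zero]
      obtain ⟨d, hd, -, h⟩ := exists_initialForm_eq_weightPart u hf0
      rw [h, a.as_sum, Finset.sum_mul, map_sum]
      refine Finset.sum_eq_zero fun s _ => ?_
      rw [monomial_mul_weightPart]
      exact linExt_topNf_weightPart hu (I.mul_mem_left _ hf)
        (weight_le_of_mem_support_monomial_mul hd s _)
    · intro a
      rw [mul_zero, map_zero]
    · intro x y _ _ hx hy a
      rw [mul_add, map_add, hx, hy, add_zero]
    · intro r x _ hx a
      rw [smul_eq_mul, ← mul_assoc]
      exact hx _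

theorem eq_zero_of_mem_initialIdeal {u : Fin n → ℝ} (hu : u ∈ normalCone m I)
    {p : MvPolynomial (Fin n) k} (hp : p ∈ initialIdeal u I)
    (h : ∀ e ∈ p.support, e ∉ leadExps m I) : p = 0 := by
  rw [← linExt_topNf_eq_zero_iff hu, linExt_eq_self fun b hb => topNf_of_notMem u (h b hb)] at hp
  exact hp

/-! ### Equality of initial ideals -/

/-- The truncations for u and v are congruent modulo the common initial ideal and standard, hence
equal; the exponent e survives in one, so it survives in the other. -/
theorem weight_eq_of_initialIdeal_eq {u v : Fin n → ℝ} (hu : u ∈ normalCone m I)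
    (hv : v ∈ normalCone m I) (h : initialIdeal u I = initialIdeal v I) {b e : Fin n →₀ ℕ}
    (he : e ∈ (nf m I b).support) (hw : weight u e = weight u b) : weight v e = weight v b := by
  classical
  have h1 : topNf m I u b - topNf m I v b ∈ initialIdeal v I := by
    have := Ideal.sub_mem _ (sub_topNf_mem hv b) (h ▸ sub_topNf_mem hu b)
    rwa [sub_sub_sub_cancel_left] at this
  have h2 := eq_zero_of_mem_initialIdeal hv h1 fun e he => by
    rcases Finset.mem_union.1 (support_sub _ _ _ he) with h | h
    · exact notMem_leadExps_of_mem_nf (mem_nf_of_mem_topNf h).1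
    · exact notMem_leadExps_of_mem_nf (mem_nf_of_mem_topNf h).1
  rw [sub_eq_zero] at h2
  have h3 : e ∈ (topNf m I v b).support := by
    rw [← h2, mem_support_iff, topNf, coeff_weightPart, if_pos hw]
    exact mem_support_iff.1 he
  exact (mem_nf_of_mem_topNf h3).2

/-- If e exceeded b in u-degree, the initial form of x^b minus its normal form would lose x^b and be
a nonzero element of in_v(I) with only standard monomials. -/
theorem mem_normalCone_of_initialIdeal_eq {u v : Fin n → ℝ} (hv : v ∈ normalCone m I)
    (h : initialIdeal u I = initialIdeal v I) : u ∈ normalCone m I := by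
  classical
  intro b e he
  by_cases hb : b ∈ leadExps m I
  · by_contra hlt
    have hlt := not_le.1 hlt
    have hne : monomial b 1 - nf m I b ≠ 0 := by
      intro h0
      have := coeff_self_sub_nf hb
      rw [h0, coeff_zero] at this
      exact zero_ne_one this
    have heb : b ≠ e := fun h => notMem_leadExps_of_mem_nf he (h ▸ hb)
    have he' : e ∈ (monomial b 1 - nf m I b).support := by
      rw [mem_support_iff, coeff_sub, coeff_monomial, if_neg heb, zero_sub, neg_ne_zero]
      exact mem_support_iff.1 he
    refine initialForm_ne_zero u hne (eq_zero_of_mem_initialIdeal hv ?_ ?_)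
    · rw [← h]
      exact Ideal.subset_span ⟨_, sub_nf_mem m I b, rfl⟩
    · intro a ha
      rw [mem_support_iff, coeff_initialForm] at ha
      split_ifs at ha with h'
      · rcases mem_of_mem_support_sub_nf (mem_support_iff.2 ha) with rfl | h1
        · exact absurd (h' e he') (not_le.2 hlt)
        · exact notMem_leadExps_of_mem_nf h1
      · exact absurd rfl ha
  · rw [nf_of_notMem hb, support_monomial, if_neg one_ne_zero, Finset.mem_singleton] at he
    rw [he]

/-- The initial ideal is the kernel of the truncated reduction, so it is encoded by the pattern of
ties between monomials and the terms of their normal forms. -/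
theorem initialIdeal_eq_iff {u v : Fin n → ℝ} (hv : v ∈ normalCone m I) :
    initialIdeal u I = initialIdeal v I ↔ u ∈ normalCone m I ∧
      ∀ b, ∀ e ∈ (nf m I b).support, weight u e = weight u b ↔ weight v e = weight v b := by
  classical
  constructor
  · intro h
    have hu := mem_normalCone_of_initialIdeal_eq hv h
    exact ⟨hu, fun b e he => ⟨weight_eq_of_initialIdeal_eq hu hv h he,
      weight_eq_of_initialIdeal_eq hv hu h.symm he⟩⟩
  · rintro ⟨hu, h⟩
    have : topNf m I u = topNf m I v := by
      ext b e
      rw [topNf, topNf, coeff_weightPart, coeff_weightPart]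
      by_cases he : e ∈ (nf m I b).support
      · exact if_congr (h b e he) rfl rfl
      · rw [notMem_support_iff.1 he]
        simp
    ext p
    rw [← linExt_topNf_eq_zero_iff hu, ← linExt_topNf_eq_zero_iff hv, this]

theorem isClosed_normalCone : IsClosed (normalCone m I) := by
  have : normalCone m I = ⋂ b, ⋂ e ∈ (nf m I b).support, {u | weight u e ≤ weight u b} := by
    ext u
    simp [normalCone]
  rw [this]
  exact isClosed_iInter fun b => isClosed_biInter fun e _ =>
    isClosed_le (continuous_weight e) (continuous_weight b)

theorem vectorCone_eq {v : Fin n → ℝ} (hv : v ∈ normalCone m I) :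
    vectorCone I v = {u | u ∈ normalCone m I ∧
      ∀ b, ∀ e ∈ (nf m I b).support, weight v e = weight v b → weight u e = weight u b} := by
  apply Set.Subset.antisymm
  · refine closure_minimal ?_ ?_
    · intro u hu
      have := (initialIdeal_eq_iff hv).1 hu
      exact ⟨this.1, fun b e he h => (this.2 b e he).2 h⟩
    · have : {u | u ∈ normalCone m I ∧ ∀ b, ∀ e ∈ (nf m I b).support,
          weight v e = weight v b → weight u e = weight u b} = normalCone m I ∩
          ⋂ b, ⋂ e ∈ (nf m I b).support, ⋂ (_ : weight v e = weight v b),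
            {u | weight u e = weight u b} := by
        ext u
        simp
      rw [this]
      exact isClosed_normalCone.inter (isClosed_iInter fun b => isClosed_biInter fun e _ =>
        isClosed_iInter fun _ => isClosed_eq (continuous_weight e) (continuous_weight b))
  · rintro u ⟨hu, h⟩
    -- For t > 0 the ties of u + t • v are exactly those of v, so u is a limit of vectors in the
    -- class of v.
    have hlim : Tendsto (fun t : ℝ => u + t • v) (𝓝[>] 0) (𝓝 (u + (0 : ℝ) • v)) :=
      Tendsto.mono_left (Continuous.tendsto (by fun_prop) 0) nhdsWithin_le_nhds
    rw [zero_smul, add_zero] at hlim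
    refine mem_closure_of_tendsto hlim ?_
    filter_upwards [self_mem_nhdsWithin] with t ht
    have ht : 0 < t := ht
    refine (initialIdeal_eq_iff hv).2 ⟨fun b e he => ?_, fun b e he => ?_⟩
    all_goals
      simp only [weight_add_left, weight_smul_left]
      have h1 := hu b e he
      have h2 := hv b e he
      have h3 := h b e he
    · gcongr
    · constructor
      · intro h4
        refine h2.antisymm (not_lt.1 fun hlt => ?_)
        nlinarith
      · intro h4
        rw [h3 h4, h4]

end GFan

namespace GFan

open MvPolynomial

variable {n : ℕ} {k : Type*} [Field k]

/-! ### Finitely many inequalities suffice -/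

variable (m : MonomialOrder.{0, 0} (Fin n)) (I : Ideal (MvPolynomial (Fin n) k))

/-- Dickson's lemma: the minimal elements of L form an antichain in a well-quasi-order. -/
theorem exists_finite_basis (L : Set (Fin n →₀ ℕ)) :
    ∃ B : Finset (Fin n →₀ ℕ), (∀ b ∈ B, b ∈ L) ∧ ∀ b ∈ L, ∃ b₀ ∈ B, b₀ ≤ b := by
  have hfin : {b | Minimal (· ∈ L) b}.Finite :=
    WellQuasiOrderedLE.finite_of_isAntichain (setOfPred_minimal_antichain _)
  refine ⟨hfin.toFinset, fun b hb => ?_, fun b hb => ?_⟩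
  · have hb : Minimal (· ∈ L) b := hfin.mem_toFinset.1 hb
    exact hb.1
  · obtain ⟨b₀, hle, hmin⟩ := exists_minimal_le_of_wellFoundedLT (· ∈ L) b hb
    exact ⟨b₀, hfin.mem_toFinset.2 hmin, hle⟩

/-- Exponents of monomials generating the initial ideal of `I`. -/
noncomputable def basisExps : Finset (Fin n →₀ ℕ) := (exists_finite_basis (leadExps m I)).choose

open Classical in
/-- Normals of finitely many inequalities defining `normalCone m I`. -/
noncomputable def constraints : Finset (Fin n → ℝ) :=
  (basisExps m I).biUnion fun b => (nf m I b).support.image fun e => expDiff e b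

variable {m I}

theorem mem_leadExps_of_mem_basisExps {b : Fin n →₀ ℕ} (hb : b ∈ basisExps m I) :
    b ∈ leadExps m I :=
  (exists_finite_basis (leadExps m I)).choose_spec.1 b hb

theorem mem_constraints {a : Fin n → ℝ} : a ∈ constraints m I ↔
    ∃ b ∈ basisExps m I, ∃ e ∈ (nf m I b).support, expDiff e b = a := by
  simp [constraints]

/-- Since x^a (x^b₀ - nf b₀) lies in I, the normal form of x^(a+b₀) is that of x^a · nf b₀; hence
each of its terms occurs in the normal form of some x^(a+c). -/
theorem exists_reduction {b e : Fin n →₀ ℕ} (hb : b ∈ leadExps m I)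
    (he : e ∈ (nf m I b).support) : ∃ b₀ ∈ basisExps m I, ∃ c ∈ (nf m I b₀).support, ∃ a,
      b = a + b₀ ∧ e ∈ (nf m I (a + c)).support := by
  classical
  obtain ⟨b₀, hb₀, hle⟩ := (exists_finite_basis (leadExps m I)).choose_spec.2 b hb
  obtain ⟨a, rfl⟩ : ∃ a, b = a + b₀ := ⟨b - b₀, (tsub_add_cancel_of_le hle).symm⟩
  have h1 : monomial (a + b₀) 1 - monomial a 1 * nf m I b₀ ∈ I := by
    have := I.mul_mem_left (monomial a 1) (sub_nf_mem m I b₀)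
    rwa [mul_sub, monomial_mul, mul_one] at this
  rw [← linExt_nf_eq_zero_iff (m := m), map_sub, linExt_monomial, one_smul, sub_eq_zero] at h1
  rw [h1] at he
  obtain ⟨c, hc, hec⟩ := exists_of_mem_support_linExt he
  rw [mem_support_iff, coeff_monomial_mul'] at hc
  split_ifs at hc with hac
  · rw [one_mul] at hc
    refine ⟨b₀, hb₀, c - a, mem_support_iff.2 hc, a, rfl, ?_⟩
    rwa [add_tsub_cancel_of_le hac]
  · exact absurd rfl hc

/-- By induction along m: the degree of e is at most that of a + c, which is at most that of a + b₀
by the inequality attached to b₀ and c. -/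
theorem mem_normalCone_iff {u : Fin n → ℝ} :
    u ∈ normalCone m I ↔ u ∈ dualCone (constraints m I) := by
  classical
  constructor
  · intro hu a ha
    obtain ⟨b, -, e, he, rfl⟩ := mem_constraints.1 ha
    rw [dotProduct_expDiff, sub_nonneg]
    exact hu b e he
  · intro hu b
    induction hs : m.toSyn b using WellFoundedLT.induction generalizing b with
    | ind s ih =>
    subst hs
    intro e he
    by_cases hb : b ∈ leadExps m I
    · obtain ⟨b₀, hb₀, c, hc, a, rfl, he'⟩ := exists_reduction hb he
      have hlt : m.toSyn (a + c) < m.toSyn (a + b₀) := by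
        rw [map_add, map_add]
        gcongr
        exact lt_of_mem_nf (mem_leadExps_of_mem_basisExps hb₀) hc
      have h1 := ih _ hlt (a + c) rfl e he'
      have h2 := hu _ (mem_constraints.2 ⟨b₀, hb₀, c, hc, rfl⟩)
      rw [dotProduct_expDiff] at h2
      rw [weight_add] at h1 ⊢
      linarith
    · rw [nf_of_notMem hb, support_monomial, if_neg one_ne_zero, Finset.mem_singleton] at he
      rw [he]

theorem normalCone_eq : normalCone m I = dualCone (constraints m I) :=
  Set.ext fun _ => mem_normalCone_iff

theorem weight_lt_of_interior {u : Fin n → ℝ} (hu : ∀ a ∈ constraints m I, 0 < u ⬝ᵥ a)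
    {b e : Fin n →₀ ℕ} (hb : b ∈ leadExps m I) (he : e ∈ (nf m I b).support) :
    weight u e < weight u b := by
  obtain ⟨b₀, hb₀, c, hc, a, rfl, he'⟩ := exists_reduction hb he
  have h1 := (mem_normalCone_iff.2 fun a ha => (hu a ha).le) (a + c) e he'
  have h2 := hu _ (mem_constraints.2 ⟨b₀, hb₀, c, hc, rfl⟩)
  rw [dotProduct_expDiff] at h2
  rw [weight_add] at h1 ⊢
  linarith

/-! ### Cones of initial ideals as faces of the normal cone -/

theorem isExtreme_vectorCone {v : Fin n → ℝ} (hv : v ∈ dualCone (constraints m I)) :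
    IsExtreme (vectorCone I v) (dualCone (constraints m I)) := by
  rw [vectorCone_eq (mem_normalCone_iff.2 hv), ← normalCone_eq]
  have hiff : ∀ x : Fin n → ℝ, x ∈ normalCone m I ↔ x ∈ dualCone (constraints m I) :=
    fun _ => mem_normalCone_iff
  refine ⟨fun x hx => hx.1, ⟨(hiff 0).2 (dualCone_zero _), fun b e _ _ => by simp [weight]⟩,
    fun x hx y hy => ⟨(hiff _).2 (dualCone_add ((hiff x).1 hx.1) ((hiff y).1 hy.1)),
      fun b e he h => ?_⟩,
    fun t ht x hx => ⟨(hiff _).2 (dualCone_smul ht ((hiff x).1 hx.1)), fun b e he h => ?_⟩,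
    fun x hx y hy hxy => ⟨hx, fun b e he h => ?_⟩⟩
  · rw [weight_add_left, weight_add_left, hx.2 b e he h, hy.2 b e he h]
  · rw [weight_smul_left, weight_smul_left, hx.2 b e he h]
  · have := hxy.2 b e he h
    rw [weight_add_left, weight_add_left] at this
    linarith [hx b e he, hy b e he]

theorem mem_vectorCone_self (I : Ideal (MvPolynomial (Fin n) k)) (v : Fin n → ℝ) :
    v ∈ vectorCone I v :=
  subset_closure rfl

/-- `vectorCone I v` is the smallest face of the normal cone containing `v`. -/
theorem vectorCone_subset {v : Fin n → ℝ} {F : Set (Fin n → ℝ)}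
    (hF : IsExtreme F (dualCone (constraints m I))) (hv : v ∈ F) : vectorCone I v ⊆ F := by
  intro u hu
  refine hF.mem_of_relint hv ((isExtreme_vectorCone (hF.sub hv)).sub hu) fun a ha h => ?_
  obtain ⟨b, hb, e, he, rfl⟩ := mem_constraints.1 ha
  rw [vectorCone_eq (mem_normalCone_iff.2 (hF.sub hv))] at hu
  rw [dotProduct_expDiff, sub_eq_zero] at h ⊢
  exact (hu.2 b e he h.symm).symm

/-- `F` is the smallest face containing a relative interior point of it. -/
theorem eq_vectorCone_of_relint {w : Fin n → ℝ} {F : Set (Fin n → ℝ)}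
    (hF : IsExtreme F (dualCone (constraints m I))) (hw : w ∈ F)
    (h : ∀ a ∈ constraints m I, w ⬝ᵥ a = 0 → ∀ y ∈ F, y ⬝ᵥ a = 0) : F = vectorCone I w := by
  refine Set.Subset.antisymm (fun y hy => ?_) (vectorCone_subset hF hw)
  exact (isExtreme_vectorCone (hF.sub hw)).mem_of_relint (mem_vectorCone_self I w) (hF.sub hy)
    fun a ha h' => h a ha h' y hy

/-- Off the boundary there are no ties, so the truncated reduction kills every leading monomial and
fixes every standard one; its kernel is the monomial ideal. -/
theorem initialIdeal_eq_termInitialIdeal {u : Fin n → ℝ}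
    (hu : ∀ a ∈ constraints m I, 0 < u ⬝ᵥ a) : initialIdeal u I = termInitialIdeal m I := by
  have huD : u ∈ normalCone m I := mem_normalCone_iff.2 fun a ha => (hu a ha).le
  have h0 : ∀ b ∈ leadExps m I, topNf m I u b = 0 := by
    intro b hb
    rw [← support_eq_empty, Finset.eq_empty_iff_forall_notMem]
    intro e he
    have := mem_nf_of_mem_topNf he
    exact (weight_lt_of_interior hu hb this.1).ne this.2
  apply le_antisymm
  · intro p hp
    rw [← linExt_topNf_eq_zero_iff huD] at hp
    have h1 : p - linExt (topNf m I u) p ∈ termInitialIdeal m I := by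
      refine sub_linExt_mem (fun b => ?_) p
      by_cases hb : b ∈ leadExps m I
      · rw [h0 b hb, sub_zero]
        obtain ⟨f, hf, hf0, rfl⟩ := hb
        have hc : m.leadingCoeff f ≠ 0 := m.leadingCoeff_ne_zero_iff.2 hf0
        have h2 : m.leadingTerm f ∈ termInitialIdeal m I := Ideal.subset_span ⟨f, ⟨hf, hf0⟩, rfl⟩
        have h3 := Ideal.mul_mem_left _ (C (m.leadingCoeff f)⁻¹) h2
        rwa [MonomialOrder.leadingTerm, C_mul_monomial, inv_mul_cancel₀ hc] at h3
      · rw [topNf_of_notMem u hb, sub_self]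
        exact Ideal.zero_mem _
    rwa [hp, sub_zero] at h1
  · refine Ideal.span_le.2 ?_
    rintro _ ⟨f, ⟨hf, hf0⟩, rfl⟩
    rw [SetLike.mem_coe, ← linExt_topNf_eq_zero_iff huD, MonomialOrder.leadingTerm,
      linExt_monomial, h0 _ ⟨f, hf, hf0, rfl⟩, smul_zero]

theorem vectorCone_of_interior {u : Fin n → ℝ} (hu : ∀ a ∈ constraints m I, 0 < u ⬝ᵥ a) :
    vectorCone I u = dualCone (constraints m I) := by
  have huD : u ∈ dualCone (constraints m I) := fun a ha => (hu a ha).le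
  refine (eq_vectorCone_of_relint (isExtreme_self _) huD fun a ha h => ?_).symm
  exact absurd h (hu a ha).ne'

/-! ### Vectors representing a term order -/

theorem nsmul_mem_of_add_mem {M : Type*} [AddCommMonoid M] {P : Set M}
    (hadd : ∀ x ∈ P, ∀ y ∈ P, x + y ∈ P) {x : M} (hx : x ∈ P) :
    ∀ c : ℕ, (c + 1) • x ∈ P := by
  intro c
  induction c with
  | zero => simpa using hx
  | succ c ih =>
    rw [succ_nsmul]
    exact hadd _ ih _ hx

theorem zsmul_mem_of_add_mem {M : Type*} [AddCommGroup M] {P : Set M}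
    (hadd : ∀ x ∈ P, ∀ y ∈ P, x + y ∈ P) {x : M} (hx : x ∈ P) {c : ℤ} (hc : 0 < c) :
    c • x ∈ P := by
  obtain ⟨d, rfl⟩ := Int.eq_succ_of_zero_lt hc
  have := nsmul_mem_of_add_mem hadd hx d
  rw [← natCast_zsmul] at this
  exact this

theorem exists_gt_abs {ι : Type*} (s : Finset ι) (f : ι → ℤ) :
    ∃ K : ℤ, 0 < K ∧ ∀ i ∈ s, |f i| < K := by
  have hnn : ∀ i ∈ s, 0 ≤ |f i| := fun i _ => abs_nonneg _
  refine ⟨∑ i ∈ s, |f i| + 1, by linarith [Finset.sum_nonneg hnn], fun i hi => ?_⟩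
  linarith [Finset.single_le_sum hnn hi]

/-- An integral form of Gordan's theorem: finitely many elements of an additively closed set not
containing zero have a common positive linear form. -/
theorem exists_forall_dotProduct_pos {P : Set (Fin n → ℤ)}
    (hadd : ∀ x ∈ P, ∀ y ∈ P, x + y ∈ P) (h0 : 0 ∉ P) {ι : Type*} (s : Finset ι)
    (f : ι → Fin n → ℤ) (hf : ∀ i ∈ s, f i ∈ P) :
    ∃ u : Fin n → ℤ, ∀ i ∈ s, 0 < u ⬝ᵥ f i := by
  classical
  induction s using Finset.induction_on generalizing f with
  | empty => exact ⟨0, by simp⟩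
  | insert j s hj ih =>
    have hfs : ∀ i ∈ s, f i ∈ P := fun i hi => hf i (Finset.mem_insert_of_mem hi)
    have hfj : f j ∈ P := hf j (Finset.mem_insert_self j s)
    obtain ⟨u, hu⟩ := ih f hfs
    rcases lt_trichotomy (u ⬝ᵥ f j) 0 with hlt | heq | hgt
    -- Here `f j` is on the wrong side of u. Each `f i` is combined with `f j` into an element of P
    -- orthogonal to u. If w is positive on these, then v = -(u ⬝ᵥ f j) • w + (w ⬝ᵥ f j) • u
    -- vanishes on `f j` and is at least 1 on each `f i`, so K • v - u is positive on all for K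
    -- large.
    · obtain ⟨w, hw⟩ := ih (fun i => (u ⬝ᵥ f i) • f j + (-(u ⬝ᵥ f j)) • f i) fun i hi =>
        hadd _ (zsmul_mem_of_add_mem hadd hfj (hu i hi)) _
          (zsmul_mem_of_add_mem hadd (hfs i hi) (neg_pos.2 hlt))
      obtain ⟨K, hK, hKs⟩ := exists_gt_abs s fun i => u ⬝ᵥ f i
      refine ⟨K • ((-(u ⬝ᵥ f j)) • w + (w ⬝ᵥ f j) • u) - u, fun i hi => ?_⟩
      rcases Finset.mem_insert.1 hi with rfl | hi
      · simp only [sub_dotProduct, smul_dotProduct, add_dotProduct, smul_eq_mul]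
        nlinarith
      · have h1 := hw i hi
        have h2 := (abs_lt.1 (hKs i hi)).2
        simp only [dotProduct_add, dotProduct_smul, smul_eq_mul] at h1
        simp only [sub_dotProduct, smul_dotProduct, add_dotProduct, smul_eq_mul]
        nlinarith
    · have hne : f j ≠ 0 := fun h => h0 (h ▸ hfj)
      obtain ⟨w, hw⟩ : ∃ w : Fin n → ℤ, 0 < w ⬝ᵥ f j :=
        ⟨f j, lt_of_le_of_ne (Finset.sum_nonneg fun i _ => mul_self_nonneg _)
          fun h => hne (dotProduct_self_eq_zero.1 h.symm)⟩
      obtain ⟨K, hK, hKs⟩ := exists_gt_abs s fun i => w ⬝ᵥ f i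
      -- u vanishes on `f j`, so w decides there; elsewhere the large multiple of u dominates w.
      refine ⟨K • u + w, fun i hi => ?_⟩
      rcases Finset.mem_insert.1 hi with rfl | hi
      · rw [add_dotProduct, smul_dotProduct, heq, smul_zero, zero_add]
        exact hw
      · have h1 := hu i hi
        have h2 := (abs_lt.1 (hKs i hi)).1
        rw [add_dotProduct, smul_dotProduct, smul_eq_mul]
        nlinarith
    · refine ⟨u, fun i hi => ?_⟩
      rcases Finset.mem_insert.1 hi with rfl | hi
      · exact hgt
      · exact hu i hi

/-- The differences b - a with a smaller than b are closed under addition and omit zero, so the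
integral Gordan theorem applies. -/
theorem exists_weight_lt (m : MonomialOrder.{0, 0} (Fin n))
    (T : Finset ((Fin n →₀ ℕ) × (Fin n →₀ ℕ))) (hT : ∀ p ∈ T, m.toSyn p.1 < m.toSyn p.2) :
    ∃ u : Fin n → ℝ, ∀ p ∈ T, weight u p.1 < weight u p.2 := by
  let P : Set (Fin n → ℤ) := {x | ∃ a b : Fin n →₀ ℕ, m.toSyn a < m.toSyn b ∧
    x = fun i => (b i : ℤ) - (a i : ℤ)}
  have hadd : ∀ x ∈ P, ∀ y ∈ P, x + y ∈ P := by
    rintro _ ⟨a, b, hab, rfl⟩ _ ⟨a', b', hab', rfl⟩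
    refine ⟨a + a', b + b', ?_, ?_⟩
    · rw [map_add, map_add]
      exact add_lt_add hab hab'
    · ext i
      simp only [Pi.add_apply, Finsupp.add_apply, Nat.cast_add]
      ring
  have h0 : (0 : Fin n → ℤ) ∉ P := by
    rintro ⟨a, b, hab, h⟩
    have : a = b := by
      ext i
      have := congrFun h i
      simp only [Pi.zero_apply] at this
      omega
    rw [this] at hab
    exact lt_irrefl _ hab
  obtain ⟨u, hu⟩ := exists_forall_dotProduct_pos hadd h0 T
    (fun p i => (p.2 i : ℤ) - (p.1 i : ℤ)) fun p hp => ⟨p.1, p.2, hT p hp, rfl⟩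
  refine ⟨fun i => (u i : ℝ), fun p hp => ?_⟩
  have h1 := hu p hp
  rw [← sub_pos, ← dotProduct_expDiff]
  have h2 : (fun i => (u i : ℝ)) ⬝ᵥ expDiff p.1 p.2 =
      ((u ⬝ᵥ fun i => (p.2 i : ℤ) - (p.1 i : ℤ) : ℤ) : ℝ) := by
    simp [dotProduct, expDiff]
  rw [h2]
  exact_mod_cast h1

theorem weight_single (u : Fin n → ℝ) (i : Fin n) : weight u (Finsupp.single i 1) = u i := by
  classical
  unfold weight dotProduct
  rw [Finset.sum_eq_single i]
  · simp
  · intro j _ hj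
    simp [hj.symm]
  · simp

theorem exists_interior (m : MonomialOrder.{0, 0} (Fin n)) (I : Ideal (MvPolynomial (Fin n) k))
    (T : Finset ((Fin n →₀ ℕ) × (Fin n →₀ ℕ))) (hT : ∀ p ∈ T, m.toSyn p.1 < m.toSyn p.2) :
    ∃ u : Fin n → ℝ, (∀ i, 0 < u i) ∧ (∀ a ∈ constraints m I, 0 < u ⬝ᵥ a) ∧
      ∀ p ∈ T, weight u p.1 < weight u p.2 := by
  classical
  -- The pairs (0, single i 1) force positive coordinates, and the pairs (e, b) force strictness of
  -- all constraints.
  obtain ⟨u, hu⟩ := exists_weight_lt m (T ∪ (Finset.univ.image fun i => (0, Finsupp.single i 1)) ∪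
    (basisExps m I).biUnion fun b => (nf m I b).support.image fun e => (e, b)) (by
      intro p hp
      simp only [Finset.mem_union, Finset.mem_image, Finset.mem_univ, true_and,
        Finset.mem_biUnion] at hp
      rcases hp with (hp | ⟨i, rfl⟩) | ⟨b, hb, e, he, rfl⟩
      · exact hT p hp
      · exact m.toSyn_strictMono (by simp [pos_iff_ne_zero])
      · exact lt_of_mem_nf (mem_leadExps_of_mem_basisExps hb) he)
  simp only [Finset.mem_union, Finset.mem_image, Finset.mem_univ, true_and,
    Finset.mem_biUnion] at hu
  refine ⟨u, fun i => ?_, fun a ha => ?_, fun p hp => hu p (Or.inl (Or.inl hp))⟩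
  · have := hu (0, Finsupp.single i 1) (Or.inl (Or.inr ⟨i, rfl⟩))
    rwa [weight_zero, weight_single] at this
  · obtain ⟨b, hb, e, he, rfl⟩ := mem_constraints.1 ha
    rw [dotProduct_expDiff, sub_pos]
    exact hu (e, b) (Or.inr ⟨b, hb, e, he, rfl⟩)

theorem termCone_eq (m : MonomialOrder.{0, 0} (Fin n)) (I : Ideal (MvPolynomial (Fin n) k)) :
    termCone I m = dualCone (constraints m I) := by
  obtain ⟨u, -, hu, -⟩ := exists_interior m I ∅ (by simp)
  rw [← vectorCone_of_interior hu, termCone, ← initialIdeal_eq_termInitialIdeal hu, vectorCone]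

/-! ### Refining additive maps to term orders -/

/-- The type of exponents, ordered by `φ` and then by `m`. -/
def RefinedSyn {Γ : Type} [AddCommGroup Γ] (_φ : (Fin n →₀ ℕ) →+ Γ)
    (_m : MonomialOrder.{0, 0} (Fin n)) : Type :=
  Fin n →₀ ℕ

/-- The term order comparing the values of `φ` first and using `m` as a tie-breaker. -/
noncomputable def refinedOrder {Γ : Type} [AddCommGroup Γ] [LinearOrder Γ] [IsOrderedAddMonoid Γ]
    (φ : (Fin n →₀ ℕ) →+ Γ) (hφ : ∀ a, 0 ≤ φ a) (m : MonomialOrder.{0, 0} (Fin n)) :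
    MonomialOrder.{0, 0} (Fin n) :=
  let key : (Fin n →₀ ℕ) → Γ ×ₗ m.syn := fun a => toLex (φ a, m.toSyn a)
  have key_inj : Function.Injective key := fun a b h =>
    m.toSyn.injective (congrArg (fun x => (ofLex x).2) h)
  have key_add : ∀ a b, key (a + b) = key a + key b := fun a b => by
    change toLex (φ (a + b), m.toSyn (a + b)) = _
    rw [map_add, map_add]
    rfl
  letI i1 : AddCommMonoid (RefinedSyn φ m) := inferInstanceAs (AddCommMonoid (Fin n →₀ ℕ))
  letI i2 : LinearOrder (RefinedSyn φ m) := LinearOrder.lift' key key_inj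
  have mono : Monotone (fun a : Fin n →₀ ℕ => (show RefinedSyn φ m from a)) := by
    intro a b hab
    obtain ⟨c, rfl⟩ := exists_add_of_le hab
    change key a ≤ key (a + c)
    rw [Prod.Lex.le_iff]
    rcases (hφ c).eq_or_lt with h | h
    · right
      refine ⟨?_, m.toSyn_monotone hab⟩
      change φ a = φ (a + c)
      rw [map_add, ← h, add_zero]
    · left
      change φ a < φ (a + c)
      rw [map_add]
      exact lt_add_of_pos_right _ h
  { syn := RefinedSyn φ m
    addCommMonoidSyn := i1
    linearOrderSyn := i2
    isOrderedAddMonoid_syn := Function.Injective.isOrderedAddMonoid key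
      key_add Iff.rfl
    toSyn := AddEquiv.refl (Fin n →₀ ℕ)
    toSyn_monotone := mono
    -- Γ itself need not be well-founded. As φ is nonnegative, the order extends divisibility, a
    -- well-quasi-order by Dickson's lemma.
    wellFoundedLT_syn := by
      have : WellQuasiOrderedLE (RefinedSyn φ m) :=
        mono.wellQuasiOrderedLE_of_wellQuasiOrderedLE_of_surjective fun x => ⟨x, rfl⟩
      infer_instance }

theorem le_of_refinedOrder_le {Γ : Type} [AddCommGroup Γ] [LinearOrder Γ] [IsOrderedAddMonoid Γ]
    {φ : (Fin n →₀ ℕ) →+ Γ} {hφ : ∀ a, 0 ≤ φ a} {m : MonomialOrder.{0, 0} (Fin n)}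
    {a b : Fin n →₀ ℕ} (h : (refinedOrder φ hφ m).toSyn a ≤ (refinedOrder φ hφ m).toSyn b) :
    φ a ≤ φ b := by
  have h : toLex (φ a, m.toSyn a) ≤ toLex (φ b, m.toSyn b) := h
  rw [Prod.Lex.le_iff] at h
  rcases h with h | h
  · exact h.le
  · exact h.1.le

/-- The pair of weights given by two vectors, ordered lexicographically. -/
def weightPair (w d : Fin n → ℝ) : (Fin n →₀ ℕ) →+ ℝ ×ₗ ℝ where
  toFun a := toLex (weight w a, weight d a)
  map_zero' := by
    rw [weight_zero, weight_zero]
    rfl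
  map_add' a b := by
    rw [weight_add, weight_add]
    rfl

theorem weightPair_nonneg {w : Fin n → ℝ} (hw : ∀ i, 0 < w i) (d : Fin n → ℝ) (a : Fin n →₀ ℕ) :
    0 ≤ weightPair w d a := by
  by_cases ha : a = 0
  · rw [ha, map_zero]
  · refine le_of_lt (Prod.Lex.lt_iff.2 (Or.inl ?_))
    exact weight_pos hw ha

/-- A term order comparing `w`-degrees first and `d`-degrees next. -/
theorem exists_weight_order {w : Fin n → ℝ} (hw : ∀ i, 0 < w i) (d : Fin n → ℝ) :
    ∃ m : MonomialOrder.{0, 0} (Fin n), ∀ a b : Fin n →₀ ℕ, m.toSyn a ≤ m.toSyn b →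
      weight w a < weight w b ∨ weight w a = weight w b ∧ weight d a ≤ weight d b := by
  refine ⟨refinedOrder (weightPair w d) (weightPair_nonneg hw d) MonomialOrder.degLex,
    fun a b h => ?_⟩
  exact Prod.Lex.le_iff.1 (le_of_refinedOrder_le h)

/-- With w-degree first and d-degree as tie-breaker, inequalities tight at w hold in direction d.
Taking d as minus a facet normal selects the cone across the facet. -/
theorem exists_mem_normalCone {w : Fin n → ℝ} (hw : ∀ i, 0 < w i) (d : Fin n → ℝ)
    (I : Ideal (MvPolynomial (Fin n) k)) :
    ∃ m : MonomialOrder.{0, 0} (Fin n), w ∈ dualCone (constraints m I) ∧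
      ∀ᶠ t in 𝓝[>] (0 : ℝ), w + t • d ∈ dualCone (constraints m I) := by
  obtain ⟨m, hm⟩ := exists_weight_order hw d
  have hw' : w ∈ dualCone (constraints m I) := by
    rw [← mem_normalCone_iff]
    intro b e he
    rcases hm e b (le_of_mem_nf he) with h | h
    · exact h.le
    · exact h.1.le
  refine ⟨m, hw', eventually_mem_dualCone hw' fun a ha h => ?_⟩
  obtain ⟨b, hb, e, he, rfl⟩ := mem_constraints.1 ha
  rw [dotProduct_expDiff, sub_eq_zero] at h
  rw [dotProduct_expDiff, sub_nonneg]
  rcases hm e b (le_of_mem_nf he) with h' | h'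
  · exact absurd h.symm h'.ne
  · exact h'.2

end GFan

namespace GFan

open MvPolynomial

variable {n : ℕ} {k : Type*} [Field k]

/-! ### Facets of polyhedral cones -/

theorem IsExtreme.eq_of_mem_interior {S : Finset (Fin n → ℝ)} {F : Set (Fin n → ℝ)}
    (hF : IsExtreme F (dualCone S)) {c : Fin n → ℝ} (hc : c ∈ F) (h : ∀ a ∈ S, 0 < c ⬝ᵥ a) :
    F = dualCone S :=
  hF.sub.antisymm fun _ hy => hF.mem_of_relint hc hy fun a ha h0 => absurd h0 (h a ha).ne'

theorem dotProduct_eq_zero_of_mem_span {F : Set (Fin n → ℝ)} {a : Fin n → ℝ}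
    (h : ∀ y ∈ F, y ⬝ᵥ a = 0) {x : Fin n → ℝ} (hx : x ∈ Submodule.span ℝ F) : x ⬝ᵥ a = 0 := by
  induction hx using Submodule.span_induction with
  | mem x hx => exact h x hx
  | zero => simp
  | add x y _ _ hx hy => rw [add_dotProduct, hx, hy, add_zero]
  | smul t x _ hx => rw [smul_dotProduct, hx, smul_zero]

theorem exists_eq_smul_of_dotProduct {a b : Fin n → ℝ}
    (h : ∀ x : Fin n → ℝ, x ⬝ᵥ a = 0 → x ⬝ᵥ b = 0) : ∃ r : ℝ, b = r • a := by
  by_cases ha : a = 0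
  · refine ⟨0, ?_⟩
    rw [zero_smul]
    exact dotProduct_self_eq_zero.1 (h b (by rw [ha, dotProduct_zero]))
  have ha' : a ⬝ᵥ a ≠ 0 := fun h => ha (dotProduct_self_eq_zero.1 h)
  refine ⟨(b ⬝ᵥ a) / (a ⬝ᵥ a), ?_⟩
  have h1 : (b - ((b ⬝ᵥ a) / (a ⬝ᵥ a)) • a) ⬝ᵥ a = 0 := by
    rw [sub_dotProduct, smul_dotProduct, smul_eq_mul, div_mul_cancel₀ _ ha', sub_self]
  have h2 := h _ h1
  rw [← sub_eq_zero]
  apply dotProduct_self_eq_zero.1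
  rw [dotProduct_sub, dotProduct_smul, h1, h2, smul_zero, sub_zero]

/-- The hyperplane orthogonal to `a`. -/
def hyperplane (a : Fin n → ℝ) : Submodule ℝ (Fin n → ℝ) where
  carrier := {x | x ⬝ᵥ a = 0}
  zero_mem' := zero_dotProduct a
  add_mem' {x y} hx hy := by
    change (x + y) ⬝ᵥ a = 0
    rw [add_dotProduct, show x ⬝ᵥ a = 0 from hx, show y ⬝ᵥ a = 0 from hy, add_zero]
  smul_mem' t x hx := by
    change (t • x) ⬝ᵥ a = 0
    rw [smul_dotProduct, show x ⬝ᵥ a = 0 from hx, smul_zero]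

theorem mem_hyperplane {a x : Fin n → ℝ} : x ∈ hyperplane a ↔ x ⬝ᵥ a = 0 := Iff.rfl

theorem finrank_hyperplane {a : Fin n → ℝ} (ha : a ≠ 0) :
    Module.finrank ℝ (hyperplane a) + 1 = n := by
  let f : Module.Dual ℝ (Fin n → ℝ) :=
    { toFun := fun x => x ⬝ᵥ a
      map_add' := fun x y => add_dotProduct x y a
      map_smul' := fun t x => smul_dotProduct t x a }
  have hf : f ≠ 0 := by
    intro h
    have : f a = 0 := by rw [h]; rfl
    exact ha (dotProduct_self_eq_zero.1 this)
  have h1 := Module.Dual.finrank_ker_add_one_of_ne_zero hf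
  have h2 : LinearMap.ker f = hyperplane a := by
    ext x
    rfl
  rw [h2] at h1
  simpa using h1

theorem span_eq_hyperplane {F : Set (Fin n → ℝ)} {a : Fin n → ℝ} (h0 : 0 ∈ F)
    (hdim : dim F + 1 = n) (ha : a ≠ 0) (h : ∀ y ∈ F, y ⬝ᵥ a = 0) :
    Submodule.span ℝ F = hyperplane a := by
  refine Submodule.eq_of_le_of_finrank_eq (Submodule.span_le.2 h) ?_
  have := finrank_hyperplane ha
  rw [dim_eq_finrank_span h0] at hdim
  omega

theorem exists_eq_smul_of_vanish {F : Set (Fin n → ℝ)} {a b : Fin n → ℝ} (h0 : 0 ∈ F)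
    (hdim : dim F + 1 = n) (ha : a ≠ 0) (h : ∀ y ∈ F, y ⬝ᵥ a = 0) (hb : ∀ y ∈ F, y ⬝ᵥ b = 0) :
    ∃ r : ℝ, b = r • a := by
  refine exists_eq_smul_of_dotProduct fun x hx => dotProduct_eq_zero_of_mem_span hb ?_
  rw [span_eq_hyperplane h0 hdim ha h]
  exact hx

/-- The forms vanishing on a set of codimension one make up a line; evaluation at c fixes the sign.
-/
theorem exists_pos_smul_of_vanish {F : Set (Fin n → ℝ)} {a b c : Fin n → ℝ} (h0 : 0 ∈ F)
    (hdim : dim F + 1 = n) (h : ∀ y ∈ F, y ⬝ᵥ a = 0) (hb : ∀ y ∈ F, y ⬝ᵥ b = 0)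
    (hca : 0 < c ⬝ᵥ a) (hb0 : b ≠ 0) (hcb : 0 ≤ c ⬝ᵥ b) :
    ∃ r : ℝ, 0 < r ∧ b = r • a := by
  have ha : a ≠ 0 := by
    rintro rfl
    simp at hca
  obtain ⟨r, rfl⟩ := exists_eq_smul_of_vanish h0 hdim ha h hb
  refine ⟨r, lt_of_le_of_ne (nonneg_of_mul_nonneg_left ?_ hca) ?_, rfl⟩
  · rwa [dotProduct_smul, smul_eq_mul] at hcb
  · rintro rfl
    simp at hb0

/-- The constraints tight at a relative interior point of F vanish on its span, which is the
hyperplane of a, hence at x. -/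
theorem IsExtreme.mem_facet_iff {S : Finset (Fin n → ℝ)} {F : Set (Fin n → ℝ)}
    (hF : IsExtreme F (dualCone S)) (hdim : dim F + 1 = n) {a : Fin n → ℝ} (ha : a ≠ 0)
    (h : ∀ y ∈ F, y ⬝ᵥ a = 0) {x : Fin n → ℝ} (hx : x ∈ dualCone S) :
    x ∈ F ↔ x ⬝ᵥ a = 0 := by
  refine ⟨h x, fun hxa => ?_⟩
  obtain ⟨w, hwF, hw⟩ := exists_relint hF.sub hF.zero hF.add
  refine hF.mem_of_relint hwF hx fun b hb hwb =>
    dotProduct_eq_zero_of_mem_span (hw b hb hwb) ?_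
  rw [span_eq_hyperplane hF.zero hdim ha h]
  exact hxa

/-- Otherwise a relative interior point of F would satisfy all constraints strictly and F would be
the whole n-dimensional cone. -/
theorem IsExtreme.exists_normal {S : Finset (Fin n → ℝ)} {F : Set (Fin n → ℝ)}
    (hF : IsExtreme F (dualCone S)) (hdim : dim F + 1 = n) {c : Fin n → ℝ}
    (hc : ∀ a ∈ S, 0 < c ⬝ᵥ a) : ∃ a ∈ S, ∀ y ∈ F, y ⬝ᵥ a = 0 := by
  obtain ⟨w, hwF, hw⟩ := exists_relint hF.sub hF.zero hF.add
  by_contra! hcon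
  have hpos : ∀ a ∈ S, 0 < w ⬝ᵥ a := by
    intro a ha
    refine lt_of_le_of_ne (hF.sub hwF a ha) fun h => ?_
    obtain ⟨y, hy, hya⟩ := hcon a ha
    exact hya (hw a ha h.symm y hy)
  have := dim_dualCone hc
  rw [← hF.eq_of_mem_interior hwF hpos] at this
  omega

theorem isFacet_iff {S : Finset (Fin n → ℝ)} {F : Set (Fin n → ℝ)} {c : Fin n → ℝ}
    (hc : ∀ a ∈ S, 0 < c ⬝ᵥ a) :
    IsFacet F (dualCone S) ↔ IsExtreme F (dualCone S) ∧ dim F + 1 = n := by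
  rw [IsFacet, dim_dualCone hc, isExtreme_iff_isFace, and_assoc]

/-- Perturbation of an interior point off finitely many hyperplanes. -/
theorem exists_generic (P : Finset (Fin n → ℝ)) {c₀ : Fin n → ℝ} (hc₀ : ∀ p ∈ P, 0 < c₀ ⬝ᵥ p)
    (Z : Finset (Fin n → ℝ)) (hZ : ∀ z ∈ Z, z ≠ 0) :
    ∃ c : Fin n → ℝ, (∀ p ∈ P, 0 < c ⬝ᵥ p) ∧ ∀ z ∈ Z, c ⬝ᵥ z ≠ 0 := by
  classical
  induction Z using Finset.induction_on with
  | empty => exact ⟨c₀, hc₀, by simp⟩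
  | insert z Z _ ih =>
    obtain ⟨c, hcP, hcZ⟩ := ih fun y hy => hZ y (Finset.mem_insert_of_mem hy)
    have hz : z ⬝ᵥ z ≠ 0 := fun h =>
      hZ z (Finset.mem_insert_self z Z) (dotProduct_self_eq_zero.1 h)
    by_cases hcz : c ⬝ᵥ z = 0
    · have hlim : ∀ y : Fin n → ℝ,
          Tendsto (fun t : ℝ => (c + t • z) ⬝ᵥ y) (𝓝[>] 0) (𝓝 (c ⬝ᵥ y)) := by
        intro y
        have : Tendsto (fun t : ℝ => c ⬝ᵥ y + t * (z ⬝ᵥ y)) (𝓝[>] 0)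
            (𝓝 (c ⬝ᵥ y + 0 * (z ⬝ᵥ y))) :=
          Tendsto.mono_left (Continuous.tendsto (by fun_prop) 0) nhdsWithin_le_nhds
        rw [zero_mul, add_zero] at this
        refine this.congr fun t => ?_
        rw [add_dotProduct, smul_dotProduct, smul_eq_mul]
      have h1 : ∀ᶠ t in 𝓝[>] (0 : ℝ), ∀ p ∈ P, 0 < (c + t • z) ⬝ᵥ p := by
        rw [Filter.eventually_all_finset]
        exact fun p hp => (hlim p).eventually (lt_mem_nhds (hcP p hp))
      have h2 : ∀ᶠ t in 𝓝[>] (0 : ℝ), ∀ y ∈ Z, (c + t • z) ⬝ᵥ y ≠ 0 := by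
        rw [Filter.eventually_all_finset]
        exact fun y hy => (hlim y).eventually_ne (hcZ y hy)
      obtain ⟨t, ⟨ht1, ht2⟩, ht⟩ := ((h1.and h2).and self_mem_nhdsWithin).exists
      refine ⟨c + t • z, ht1, fun y hy => ?_⟩
      rcases Finset.mem_insert.1 hy with rfl | hy
      · rw [add_dotProduct, hcz, zero_add, smul_dotProduct, smul_eq_mul]
        exact mul_ne_zero (ne_of_gt ht) hz
      · exact ht2 y hy
    · refine ⟨c, hcP, fun y hy => ?_⟩
      rcases Finset.mem_insert.1 hy with rfl | hy
      · exact hcz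
      · exact hcZ y hy

/-! ### Parallel differences of exponents -/

/-- The factor r is a ratio M/N of integers, read off a coordinate where p and q differ. Clearing
denominators and signs gives M p + N q' = M q + N p' in ℕⁿ, which contradicts p < q together with q'
≤ p'. -/
theorem lt_of_expDiff_eq_smul (m : MonomialOrder.{0, 0} (Fin n)) {p q p' q' : Fin n →₀ ℕ}
    (hpq : m.toSyn p < m.toSyn q) {r : ℝ} (hr : 0 < r)
    (h : expDiff p' q' = r • expDiff p q) : m.toSyn p' < m.toSyn q' := by
  have hne : p ≠ q := fun h => (h ▸ hpq).ne rfl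
  obtain ⟨i, hi⟩ := Finsupp.ne_iff.1 hne
  have hi' : ∀ j, ((q' j : ℤ) - p' j : ℝ) = r * ((q j : ℤ) - p j : ℝ) := by
    intro j
    have := congrFun h j
    simpa [expDiff] using this
  set N : ℤ := (q i : ℤ) - p i with hN
  set M : ℤ := (q' i : ℤ) - p' i with hM
  have hN0 : N ≠ 0 := by omega
  have hMN : (M : ℝ) = r * N := by
    have := hi' i
    rw [hM, hN]
    push_cast at this ⊢
    exact this
  have habs : ((M.natAbs : ℕ) : ℝ) = r * (N.natAbs : ℕ) := by
    rw [Nat.cast_natAbs, Nat.cast_natAbs, Int.cast_abs, Int.cast_abs, hMN, abs_mul,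
      abs_of_pos hr]
  have hN1 : N.natAbs ≠ 0 := Int.natAbs_ne_zero.2 hN0
  have hM1 : M.natAbs ≠ 0 := by
    intro h0
    rw [h0, Nat.cast_zero, eq_comm, mul_eq_zero] at habs
    rcases habs with h | h
    · exact hr.ne' h
    · exact hN1 (by exact_mod_cast h)
  have key : M.natAbs • p + N.natAbs • q' = M.natAbs • q + N.natAbs • p' := by
    ext j
    have h1 := hi' j
    have h2 : ((M.natAbs : ℝ) * p j + N.natAbs * q' j) = M.natAbs * q j + N.natAbs * p' j := by
      rw [habs]
      push_cast at h1
      linear_combination (N.natAbs : ℝ) * h1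
    simp only [Finsupp.add_apply, Finsupp.smul_apply, smul_eq_mul]
    exact_mod_cast h2
  by_contra hle
  have hle := not_lt.1 hle
  have h1 : M.natAbs • m.toSyn p < M.natAbs • m.toSyn q := nsmul_lt_nsmul_right hM1 hpq
  have h2 : N.natAbs • m.toSyn q' ≤ N.natAbs • m.toSyn p' := nsmul_le_nsmul_right hle _
  have h3 := add_lt_add_of_lt_of_le h1 h2
  simp only [← map_nsmul, ← map_add] at h3
  exact h3.ne (by rw [key])

/-! ### The Gröbner fan is a fan -/

variable {I : Ideal (MvPolynomial (Fin n) k)}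

/-- A positive vector lies in the normal cone of an order refining its degree, and a normal cone is
the vector cone of a positive interior point. -/
theorem mem_groebnerFan_iff {F : Set (Fin n → ℝ)} : F ∈ groebnerFan I ↔
    ∃ m : MonomialOrder.{0, 0} (Fin n), IsExtreme F (dualCone (constraints m I)) := by
  constructor
  · rintro ⟨v, hv, h⟩
    obtain ⟨m, hm, -⟩ := exists_mem_normalCone hv 0 I
    have hE := isExtreme_vectorCone hm
    refine ⟨m, ?_⟩
    rcases h with rfl | h
    · exact hE
    · obtain ⟨T, hT⟩ := hE.exists_eq_dualCone
      rw [hT] at h hE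
      exact (isExtreme_iff_isFace.2 h).trans hE
  · rintro ⟨m, hF⟩
    obtain ⟨u, hu, hu', -⟩ := exists_interior m I ∅ (by simp)
    refine ⟨u, hu, Or.inr ?_⟩
    rw [vectorCone_of_interior hu']
    exact isExtreme_iff_isFace.1 hF

variable {m m₁ m₂ : MonomialOrder.{0, 0} (Fin n)}

/-- `vectorCone I (x + y)` does not mention a term order: as a face of the first cone it contains x,
and as the smallest face at x + y it lies in the second. -/
theorem mem_of_add_mem_dualCone {x y : Fin n → ℝ} (hx : x ∈ dualCone (constraints m₁ I))
    (hy : y ∈ dualCone (constraints m₁ I)) (h : x + y ∈ dualCone (constraints m₂ I)) :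
    x ∈ dualCone (constraints m₂ I) :=
  vectorCone_subset (isExtreme_self _) h
    ((isExtreme_vectorCone (dualCone_add hx hy)).ext x hx y hy (mem_vectorCone_self I _))

theorem isExtreme_inter {A B : Set (Fin n → ℝ)} (hA : IsExtreme A (dualCone (constraints m₁ I)))
    (hB : IsExtreme B (dualCone (constraints m₂ I))) :
    IsExtreme (A ∩ B) (dualCone (constraints m₁ I)) := by
  refine ⟨fun x hx => hA.sub hx.1, ⟨hA.zero, hB.zero⟩,
    fun x hx y hy => ⟨hA.add x hx.1 y hy.1, hB.add x hx.2 y hy.2⟩,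
    fun t ht x hx => ⟨hA.smul t ht x hx.1, hB.smul t ht x hx.2⟩, fun x hx y hy hxy => ?_⟩
  have h2 := hB.sub hxy.2
  exact ⟨hA.ext x hx y hy hxy.1, hB.ext x (mem_of_add_mem_dualCone hx hy h2) y
    (mem_of_add_mem_dualCone hy hx (by rwa [add_comm])) hxy.2⟩

theorem isFace_inter {A B : Set (Fin n → ℝ)} (hA : IsExtreme A (dualCone (constraints m₁ I)))
    (hB : IsExtreme B (dualCone (constraints m₂ I))) : IsFace (A ∩ B) A := by
  have h := (isExtreme_inter hA hB).of_subset Set.inter_subset_left hA.sub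
  obtain ⟨T, rfl⟩ := hA.exists_eq_dualCone
  exact (isExtreme_iff_isFace.1 h).2

theorem isFan_groebnerFan (I : Ideal (MvPolynomial (Fin n) k)) : IsFan (groebnerFan I) := by
  have hcone : ∀ C ∈ groebnerFan I, IsPolyhedralCone C := by
    intro C hC
    obtain ⟨m, hm⟩ := mem_groebnerFan_iff.1 hC
    obtain ⟨T, rfl⟩ := hm.exists_eq_dualCone
    exact isPolyhedralCone_dualCone T
  refine ⟨⟨fun C hC => (hcone C hC).isPolyhedron, fun P hP F hne hF => ?_, fun A hA B hB => ?_⟩,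
    hcone⟩
  · obtain ⟨m, hm⟩ := mem_groebnerFan_iff.1 hP
    refine mem_groebnerFan_iff.2 ⟨m, ?_⟩
    obtain ⟨T, rfl⟩ := hm.exists_eq_dualCone
    exact (isExtreme_iff_isFace.2 ⟨hne, hF⟩).trans hm
  · obtain ⟨m₁, h₁⟩ := mem_groebnerFan_iff.1 hA
    obtain ⟨m₂, h₂⟩ := mem_groebnerFan_iff.1 hB
    refine ⟨isFace_inter h₁ h₂, ?_⟩
    rw [Set.inter_comm]
    exact isFace_inter h₂ h₁

/-! ### Maximal cones, purity and rational normals -/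

theorem exists_interior_point (m : MonomialOrder.{0, 0} (Fin n))
    (I : Ideal (MvPolynomial (Fin n) k)) : ∃ c : Fin n → ℝ, ∀ a ∈ constraints m I, 0 < c ⬝ᵥ a := by
  obtain ⟨u, -, hu, -⟩ := exists_interior m I ∅ (by simp)
  exact ⟨u, hu⟩

/-- The smaller cone is a face of the larger one and has interior points, so it is all of it. -/
theorem dualCone_eq_of_subset
    (h : dualCone (constraints m₁ I) ⊆ dualCone (constraints m₂ I)) :
    dualCone (constraints m₁ I) = dualCone (constraints m₂ I) := by
  obtain ⟨c, hc⟩ := exists_interior_point m₁ I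
  have h1 := isExtreme_inter (isExtreme_self (constraints m₂ I))
    (isExtreme_self (constraints m₁ I))
  rw [Set.inter_eq_right.2 h] at h1
  exact h1.eq_of_interior hc

/-- A normal cone meeting the interior of another one equals it. -/
theorem dualCone_eq_of_mem_interior {c : Fin n → ℝ} (hc : ∀ a ∈ constraints m₁ I, 0 < c ⬝ᵥ a)
    (hc' : c ∈ dualCone (constraints m₂ I)) :
    dualCone (constraints m₁ I) = dualCone (constraints m₂ I) := by
  have h1 := isExtreme_inter (isExtreme_self (constraints m₁ I))
    (isExtreme_self (constraints m₂ I))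
  exact dualCone_eq_of_subset
    (Set.inter_eq_left.1 (h1.eq_of_mem_interior ⟨fun a ha => (hc a ha).le, hc'⟩ hc))

theorem maximal_iff {C : Set (Fin n → ℝ)} : Maximal (fun D => D ∈ groebnerFan I) C ↔
    ∃ m : MonomialOrder.{0, 0} (Fin n), C = dualCone (constraints m I) := by
  constructor
  · intro h
    obtain ⟨m, hm⟩ := mem_groebnerFan_iff.1 h.prop
    exact ⟨m, h.eq_of_subset (mem_groebnerFan_iff.2 ⟨m, isExtreme_self _⟩) hm.sub⟩
  · rintro ⟨m, rfl⟩
    refine ⟨mem_groebnerFan_iff.2 ⟨m, isExtreme_self _⟩, fun F hF hle => ?_⟩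
    obtain ⟨m', hm'⟩ := mem_groebnerFan_iff.1 hF
    have hle : dualCone (constraints m I) ⊆ F := hle
    have := dualCone_eq_of_subset (hle.trans hm'.sub)
    rw [this]
    exact hm'.sub

theorem isPureFullDimensional_groebnerFan (I : Ideal (MvPolynomial (Fin n) k)) :
    IsPureFullDimensional (groebnerFan I) := by
  rintro ⟨C, hC⟩
  obtain ⟨m, rfl⟩ := maximal_iff.1 hC
  obtain ⟨c, hc⟩ := exists_interior_point m I
  exact dim_dualCone hc

theorem exists_expDiff_of_mem_constraints {a : Fin n → ℝ} (ha : a ∈ constraints m I) :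
    ∃ e b : Fin n →₀ ℕ, m.toSyn e < m.toSyn b ∧ e ≠ b ∧ a = expDiff e b := by
  obtain ⟨b, hb, e, he, rfl⟩ := mem_constraints.1 ha
  have := lt_of_mem_nf (mem_leadExps_of_mem_basisExps hb) he
  exact ⟨e, b, this, fun h => (h ▸ this).ne rfl, rfl⟩

theorem hasRationalNormals_groebnerFan (I : Ideal (MvPolynomial (Fin n) k)) :
    HasRationalNormals (groebnerFan I) := by
  intro F hF hdim
  obtain ⟨m, hm⟩ := mem_groebnerFan_iff.1 hF
  obtain ⟨c, hc⟩ := exists_interior_point m I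
  obtain ⟨a, ha, h⟩ := hm.exists_normal hdim hc
  obtain ⟨e, b, -, hne, rfl⟩ := exists_expDiff_of_mem_constraints ha
  refine ⟨fun i => (b i : ℚ) - e i, fun h0 => hne ?_, fun x hx => ?_⟩
  · ext i
    have := congrFun h0 i
    simp only [Pi.zero_apply, sub_eq_zero, Nat.cast_inj] at this
    exact this.symm
  · rw [← h x hx]
    congr 1
    ext i
    simp [expDiff]

/-! ### The orientation -/

theorem isFacet_constraints_iff {F : Set (Fin n → ℝ)} :
    IsFacet F (dualCone (constraints m I)) ↔
      IsExtreme F (dualCone (constraints m I)) ∧ dim F + 1 = n := by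
  obtain ⟨c, hc⟩ := exists_interior_point m I
  exact isFacet_iff hc

/-- Adjacent normal cones lie on different sides of a common facet. -/
theorem facet_sides (hne : dualCone (constraints m₁ I) ≠ dualCone (constraints m₂ I))
    {F : Set (Fin n → ℝ)} (h₁ : IsFacet F (dualCone (constraints m₁ I)))
    (h₂ : IsFacet F (dualCone (constraints m₂ I))) {a : Fin n → ℝ} (ha : a ∈ constraints m₁ I)
    (haF : ∀ y ∈ F, y ⬝ᵥ a = 0) :
    (∀ x ∈ dualCone (constraints m₁ I) \ F, 0 < x ⬝ᵥ a) ∧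
      ∀ x ∈ dualCone (constraints m₂ I) \ F, x ⬝ᵥ a < 0 := by
  obtain ⟨hF₁, hdim⟩ := isFacet_constraints_iff.1 h₁
  obtain ⟨hF₂, -⟩ := isFacet_constraints_iff.1 h₂
  obtain ⟨c₁, hc₁⟩ := exists_interior_point m₁ I
  obtain ⟨c₂, hc₂⟩ := exists_interior_point m₂ I
  have ha0 : a ≠ 0 := by
    rintro rfl
    simpa using hc₁ 0 ha
  refine ⟨fun x hx => lt_of_le_of_ne (hx.1 a ha) fun h =>
    hx.2 ((hF₁.mem_facet_iff hdim ha0 haF hx.1).2 h.symm), fun x hx => ?_⟩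
  obtain ⟨b, hb, hbF⟩ := hF₂.exists_normal hdim hc₂
  have hb0 : b ≠ 0 := by
    rintro rfl
    simpa using hc₂ 0 hb
  have hxb : 0 < x ⬝ᵥ b := lt_of_le_of_ne (hx.1 b hb) fun h =>
    hx.2 ((hF₂.mem_facet_iff hdim hb0 hbF hx.1).2 h.symm)
  obtain ⟨r, rfl⟩ := exists_eq_smul_of_vanish hF₁.zero hdim hb0 hbF haF
  have hr : r < 0 := by
    -- If both cones were on the same side of F, a small step from a relative interior point of F
    -- towards `c₂` would stay in the first cone and reach the interior of the second, so the two
    -- would coincide.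
    by_contra hr
    have hr := not_lt.1 hr
    apply hne
    obtain ⟨w, hwF, hw⟩ := exists_relint hF₁.sub hF₁.zero hF₁.add
    obtain ⟨t, ht, ht'⟩ := ((eventually_mem_dualCone (y := c₂) (hF₁.sub hwF)
      fun a' ha' h0 => by
        have h1 := hc₁ _ ha'
        obtain ⟨s, hs, h2⟩ := exists_pos_smul_of_vanish hF₁.zero hdim haF (hw a' ha' h0)
          (hc₁ _ ha) (fun h => by simp [h] at h1) h1.le
        rw [h2, dotProduct_smul, dotProduct_smul]
        exact mul_nonneg hs.le (mul_nonneg hr (hc₂ b hb).le)).and self_mem_nhdsWithin).exists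
    refine (dualCone_eq_of_mem_interior (c := w + t • c₂) (fun b' hb' => ?_) ht).symm
    rw [add_dotProduct, smul_dotProduct]
    exact add_pos_of_nonneg_of_pos (hF₂.sub hwF b' hb') (mul_pos ht' (hc₂ b' hb'))
  rw [dotProduct_smul]
  exact mul_neg_of_neg_of_pos hr hxb

theorem dotProduct_expDiff_swap (x : Fin n → ℝ) (p q : Fin n →₀ ℕ) :
    x ⬝ᵥ expDiff p q = -(x ⬝ᵥ expDiff q p) := by
  rw [dotProduct_expDiff, dotProduct_expDiff]
  ring

theorem isNormalFromTo_of_constraint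
    (hne : dualCone (constraints m₁ I) ≠ dualCone (constraints m₂ I))
    {F : Set (Fin n → ℝ)} (h₁ : IsFacet F (dualCone (constraints m₁ I)))
    (h₂ : IsFacet F (dualCone (constraints m₂ I))) {e b : Fin n →₀ ℕ}
    (ha : expDiff e b ∈ constraints m₁ I) (haF : ∀ y ∈ F, y ⬝ᵥ expDiff e b = 0) :
    IsNormalFromTo F (dualCone (constraints m₁ I)) (dualCone (constraints m₂ I)) b e ∧
      IsNormalFromTo F (dualCone (constraints m₂ I)) (dualCone (constraints m₁ I)) e b := by
  obtain ⟨hpos, hneg⟩ := facet_sides hne h₁ h₂ ha haF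
  have heb : e ≠ b := by
    rintro rfl
    obtain ⟨c, hc⟩ := exists_interior_point m₁ I
    have := hc _ ha
    rw [dotProduct_expDiff, sub_self] at this
    exact lt_irrefl _ this
  have hsw : ∀ x : Fin n → ℝ, (x ⬝ᵥ fun i => (e i : ℝ) - (b i : ℝ)) = -(x ⬝ᵥ expDiff e b) :=
    fun x => dotProduct_expDiff_swap x b e
  refine ⟨⟨heb, fun x hx => ?_, fun x hx => ?_, fun x hx => ?_⟩, ⟨heb.symm, haF, hneg, hpos⟩⟩
  · rw [hsw, haF x hx, neg_zero]
  · rw [hsw, neg_lt_zero]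
    exact hpos x hx
  · rw [hsw, neg_pos]
    exact hneg x hx

theorem IsNormalFromTo.nonneg {F C D : Set (Fin n → ℝ)} {p q : Fin n →₀ ℕ}
    (h : IsNormalFromTo F C D p q) {x : Fin n → ℝ} (hx : x ∈ D) : 0 ≤ x ⬝ᵥ expDiff p q := by
  by_cases hF : x ∈ F
  · exact (h.zero x hF).ge
  · exact (h.pos x ⟨hx, hF⟩).le

theorem IsNormalFromTo.nonpos {F C D : Set (Fin n → ℝ)} {p q : Fin n →₀ ℕ}
    (h : IsNormalFromTo F C D p q) {x : Fin n → ℝ} (hx : x ∈ C) : x ⬝ᵥ expDiff p q ≤ 0 := by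
  by_cases hF : x ∈ F
  · exact (h.zero x hF).le
  · exact (h.neg x ⟨hx, hF⟩).le

theorem isOrientationOf_directed (m : MonomialOrder.{0, 0} (Fin n))
    (I : Ideal (MvPolynomial (Fin n) k)) :
    IsOrientationOf (fanGraph (groebnerFan I)) (Directed m (groebnerFan I)) := by
  refine ⟨fun v w h => h.1, ?_⟩
  rintro ⟨C, hC⟩ ⟨D, hD⟩ hadj
  obtain ⟨m₁, rfl⟩ := maximal_iff.1 hC
  obtain ⟨m₂, rfl⟩ := maximal_iff.1 hD
  have hne : dualCone (constraints m₁ I) ≠ dualCone (constraints m₂ I) := fun h =>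
    hadj.1 (Subtype.ext h)
  obtain ⟨c, hc⟩ := exists_interior_point m₁ I
  have hcC : c ∈ dualCone (constraints m₁ I) := fun a ha => (hc a ha).le
  have hnot : ¬ (Directed m (groebnerFan I) ⟨_, hC⟩ ⟨_, hD⟩ ∧
      Directed m (groebnerFan I) ⟨_, hD⟩ ⟨_, hC⟩) := by
    rintro ⟨⟨-, F, hF₁, hF₂, p, q, hN, hlt⟩, ⟨-, F', hF₁', hF₂', p', q', hN', hlt'⟩⟩
    obtain ⟨hE, hdim⟩ := isFacet_constraints_iff.1 hF₁
    have hE₂ := (isFacet_constraints_iff.1 hF₂).1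
    obtain ⟨a, ha, haF⟩ := hE.exists_normal hdim hc
    obtain ⟨r, hr, h1⟩ := exists_pos_smul_of_vanish hE.zero hdim haF
      (b := expDiff q p) (fun y hy => by
        rw [dotProduct_expDiff_swap, neg_eq_zero]
        exact hN.zero y hy) (hc a ha) (expDiff_ne_zero hN.ne)
      (by
        rw [dotProduct_expDiff_swap]
        exact neg_nonneg.2 (hN.nonpos hcC))
    -- A priori F' is another common facet; still q' - p' is nonpositive on the second cone and
    -- nonnegative on the first, so it vanishes on F, which lies in both.
    obtain ⟨r', hr', h2⟩ := exists_pos_smul_of_vanish hE.zero hdim haF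
      (b := expDiff p' q') (fun y hy => le_antisymm (hN'.nonpos (hE₂.sub hy))
        (hN'.nonneg (hE.sub hy))) (hc a ha) (expDiff_ne_zero hN'.ne.symm) (hN'.nonneg hcC)
    refine lt_asymm hlt (lt_of_expDiff_eq_smul m hlt' (r := r / r') (div_pos hr hr') ?_)
    rw [h1, h2, smul_smul, div_mul_cancel₀ _ hr'.ne']
  have hor : Directed m (groebnerFan I) ⟨_, hC⟩ ⟨_, hD⟩ ∨
      Directed m (groebnerFan I) ⟨_, hD⟩ ⟨_, hC⟩ := by
    obtain ⟨F, hF₁, hF₂⟩ := hadj.2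
    obtain ⟨hE, hdim⟩ := isFacet_constraints_iff.1 hF₁
    obtain ⟨a, ha, haF⟩ := hE.exists_normal hdim hc
    obtain ⟨e, b, -, heb, rfl⟩ := exists_expDiff_of_mem_constraints ha
    obtain ⟨h1, h2⟩ := isNormalFromTo_of_constraint hne hF₁ hF₂ ha haF
    rcases lt_trichotomy (m.toSyn e) (m.toSyn b) with h | h | h
    · exact Or.inr ⟨hadj.symm, F, hF₂, hF₁, e, b, h2, h⟩
    · exact absurd (m.toSyn.injective h) heb
    · exact Or.inl ⟨hadj, F, hF₁, hF₂, b, e, h1, h⟩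
  rcases hor with h | h
  · exact Or.inl ⟨h, fun h' => hnot ⟨h, h'⟩⟩
  · exact Or.inr ⟨h, fun h' => hnot ⟨h', h⟩⟩

/-! ### Acyclicity -/

/-- The lexicographic order on sets of exponents: at the `m`-smallest exponent where `A` and `B`
differ, it belongs to `A`. -/
def LexLT (m : MonomialOrder.{0, 0} (Fin n)) (A B : Set (Fin n →₀ ℕ)) : Prop :=
  ∃ a, a ∈ A ∧ a ∉ B ∧ ∀ b, m.toSyn b < m.toSyn a → (b ∈ A ↔ b ∈ B)

theorem LexLT.trans {A B C : Set (Fin n →₀ ℕ)} (h : LexLT m A B) (h' : LexLT m B C) :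
    LexLT m A C := by
  obtain ⟨a, haA, haB, ha⟩ := h
  obtain ⟨b, hbB, hbC, hb⟩ := h'
  rcases lt_trichotomy (m.toSyn a) (m.toSyn b) with hlt | heq | hgt
  · exact ⟨a, haA, fun hC => haB ((hb a hlt).2 hC),
      fun c hc => (ha c hc).trans (hb c (hc.trans hlt))⟩
  · rw [m.toSyn.injective heq] at haB
    exact absurd hbB haB
  · exact ⟨b, (ha b hgt).2 hbB, hbC, fun c hc => (ha c (hc.trans hgt)).trans (hb c hc)⟩

theorem LexLT.irrefl {A : Set (Fin n →₀ ℕ)} : ¬ LexLT m A A := by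
  rintro ⟨a, h1, h2, -⟩
  exact h2 h1

/-- Normal forms depend only on which monomials are standard. -/
theorem dualCone_eq_of_leadExps_eq (h : leadExps m₁ I = leadExps m₂ I) :
    dualCone (constraints m₁ I) = dualCone (constraints m₂ I) := by
  classical
  have hnf : nf m₁ I = nf m₂ I := by
    ext1 b
    rw [← sub_eq_zero]
    refine eq_zero_of_standard m₁ (I := I) ?_ fun e he => ?_
    · have := I.sub_mem (sub_nf_mem m₂ I b) (sub_nf_mem m₁ I b)
      rwa [sub_sub_sub_cancel_left] at this
    · rcases Finset.mem_union.1 (support_sub _ _ _ he) with h' | h'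
      · exact notMem_leadExps_of_mem_nf h'
      · rw [h]
        exact notMem_leadExps_of_mem_nf h'
  rw [← normalCone_eq, ← normalCone_eq, normalCone, normalCone, hnf]

/-- Let a be the smallest exponent leading for exactly one order, and suppose that it leads for
`m₂`. At a relative interior point w of F both orders give standard monomials for in_w(I). Reducing
x^a by `m₂` modulo in_w(I) then yields a nonzero element of in_w(I) that is standard for `m₁`, a
contradiction. -/
theorem lexLT_of_isNormalFromTo
    (hne : dualCone (constraints m₁ I) ≠ dualCone (constraints m₂ I)) {F : Set (Fin n → ℝ)}
    (h₁ : IsFacet F (dualCone (constraints m₁ I))) (h₂ : IsFacet F (dualCone (constraints m₂ I)))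
    {p q : Fin n →₀ ℕ}
    (hN : IsNormalFromTo F (dualCone (constraints m₁ I)) (dualCone (constraints m₂ I)) p q)
    (hlt : m.toSyn p < m.toSyn q) : LexLT m (leadExps m₁ I) (leadExps m₂ I) := by
  classical
  obtain ⟨a, ha, hmin⟩ := (InvImage.wf m.toSyn wellFounded_lt).has_min
    {a | ¬ (a ∈ leadExps m₁ I ↔ a ∈ leadExps m₂ I)} (by
      by_contra hemp
      refine hne (dualCone_eq_of_leadExps_eq (Set.ext fun a => ?_))
      by_contra h
      exact hemp ⟨a, h⟩)
  have hmin : ∀ b, m.toSyn b < m.toSyn a → (b ∈ leadExps m₁ I ↔ b ∈ leadExps m₂ I) :=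
    fun b hb => not_not.1 fun h => hmin b h hb
  have ha : ¬ (a ∈ leadExps m₁ I ↔ a ∈ leadExps m₂ I) := ha
  by_cases ha₁ : a ∈ leadExps m₁ I
  · exact ⟨a, ha₁, fun h => ha (iff_of_true ha₁ h), hmin⟩
  have ha₂ : a ∈ leadExps m₂ I := by
    by_contra h
    exact ha (iff_of_false ha₁ h)
  exfalso
  obtain ⟨hE₁, hdim⟩ := isFacet_constraints_iff.1 h₁
  obtain ⟨hE₂, -⟩ := isFacet_constraints_iff.1 h₂
  obtain ⟨c, hc⟩ := exists_interior_point m₂ I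
  obtain ⟨w, hwF, hw⟩ := exists_relint hE₂.sub hE₂.zero hE₂.add
  have hwD : w ∈ normalCone m₂ I := mem_normalCone_iff.2 (hE₂.sub hwF)
  have hFw := eq_vectorCone_of_relint hE₂ hwF hw
  rw [vectorCone_eq hwD] at hFw
  obtain ⟨z, hz, hzF⟩ := hE₂.exists_normal hdim hc
  obtain ⟨r, hr, hrz⟩ := exists_pos_smul_of_vanish hE₂.zero hdim hzF (b := expDiff p q) hN.zero
    (hc z hz) (expDiff_ne_zero hN.ne.symm) (hN.nonneg fun a ha => (hc a ha).le)
  -- A tie at w is a tie on all of F, so a - e is a positive multiple of q - p and e is m-smaller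
  -- than a; by minimality of a, standard for `m₂` then means standard for `m₁`.
  have hstd : ∀ e ∈ (topNf m₂ I w a).support, e ∉ leadExps m₁ I := by
    intro e he
    obtain ⟨he, hwe⟩ := mem_nf_of_mem_topNf he
    have hlt' := weight_lt_of_interior hc ha₂ he
    obtain ⟨s, hs, hsz⟩ := exists_pos_smul_of_vanish hE₂.zero hdim hzF (b := expDiff e a)
      (fun y hy => by
        rw [hFw] at hy
        rw [dotProduct_expDiff, hy.2 a e he hwe, sub_self])
      (hc z hz) (expDiff_ne_zero fun h => hlt'.ne (by rw [h]))
      (by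
        rw [dotProduct_expDiff]
        linarith)
    have : m.toSyn e < m.toSyn a := by
      refine lt_of_expDiff_eq_smul m hlt (r := s / r) (div_pos hs hr) ?_
      rw [hsz, hrz, smul_smul, div_mul_cancel₀ _ hr.ne']
    rw [hmin e this]
    exact notMem_leadExps_of_mem_nf he
  have h0 := eq_zero_of_mem_initialIdeal (m := m₁) (mem_normalCone_iff.2 (hE₁.sub hwF))
    (sub_topNf_mem hwD a) fun e he => by
      rcases Finset.mem_union.1 (support_sub _ _ _ he) with h | h
      · rw [support_monomial, if_neg one_ne_zero, Finset.mem_singleton] at h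
        rwa [h]
      · exact hstd e h
  rw [sub_eq_zero] at h0
  have : a ∈ (topNf m₂ I w a).support := by
    rw [← h0, support_monomial, if_neg one_ne_zero]
    exact Finset.mem_singleton_self a
  exact notMem_leadExps_of_mem_nf (mem_nf_of_mem_topNf this).1 ha₂

theorem isAcyclicRel_directed (m : MonomialOrder.{0, 0} (Fin n))
    (I : Ideal (MvPolynomial (Fin n) k)) : IsAcyclicRel (Directed m (groebnerFan I)) := by
  choose o ho using fun C : MaximalCone (groebnerFan I) => maximal_iff.1 C.2
  have hstep : ∀ C D, Directed m (groebnerFan I) C D →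
      LexLT m (leadExps (o C) I) (leadExps (o D) I) := by
    rintro C D ⟨hadj, F, hF₁, hF₂, p, q, hN, hlt⟩
    rw [ho C] at hF₁ hN
    rw [ho D] at hF₂ hN
    refine lexLT_of_isNormalFromTo (fun h => hadj.1 (Subtype.ext ?_)) hF₁ hF₂ hN hlt
    rw [ho C, ho D, h]
  intro C hC
  have : ∀ D, Relation.TransGen (Directed m (groebnerFan I)) C D →
      LexLT m (leadExps (o C) I) (leadExps (o D) I) := by
    intro D hD
    induction hD with
    | single h => exact hstep _ _ h
    | tail _ h ih => exact ih.trans (hstep _ _ h)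
  exact LexLT.irrefl (this C hC)

/-! ### The sink -/

/-- Constraint normals b - e of this cone have e smaller than b and point inwards, so every outward
normal points to the smaller monomial. -/
theorem isSink_directed_of_eq (m : MonomialOrder.{0, 0} (Fin n))
    (I : Ideal (MvPolynomial (Fin n) k)) (C : MaximalCone (groebnerFan I))
    (hC : C.1 = dualCone (constraints m I)) : IsSink (Directed m (groebnerFan I)) C := by
  rintro D ⟨-, F, hF, -, p, q, hN, hlt⟩
  rw [hC] at hF hN
  obtain ⟨hE, hdim⟩ := isFacet_constraints_iff.1 hF
  obtain ⟨c, hc⟩ := exists_interior_point m I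
  obtain ⟨a, ha, haF⟩ := hE.exists_normal hdim hc
  obtain ⟨r, hr, h1⟩ := exists_pos_smul_of_vanish hE.zero hdim haF
    (b := expDiff q p) (fun y hy => by
      rw [dotProduct_expDiff_swap, neg_eq_zero]
      exact hN.zero y hy) (hc a ha) (expDiff_ne_zero hN.ne)
    (by
      rw [dotProduct_expDiff_swap]
      exact neg_nonneg.2 (hN.nonpos fun a ha => (hc a ha).le))
  obtain ⟨e, b, hlt', -, rfl⟩ := exists_expDiff_of_mem_constraints ha
  exact lt_asymm hlt (lt_of_expDiff_eq_smul m hlt' hr h1)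

/-- A ray from a generic positive interior point leaves the cone through the relative interior of
a facet. -/
theorem exists_exit_point {S : Finset (Fin n → ℝ)} {c₀ u : Fin n → ℝ} (hc₀ : ∀ i, 0 < c₀ i)
    (hc₀S : ∀ a ∈ S, 0 < c₀ ⬝ᵥ a) (hu : ∀ i, 0 < u i) (huS : u ∉ dualCone S) :
    ∃ a ∈ S, u ⬝ᵥ a < 0 ∧ ∃ w ∈ dualCone S, (∀ i, 0 < w i) ∧ w ⬝ᵥ a = 0 ∧
      ∀ b ∈ S, w ⬝ᵥ b = 0 → ∃ r : ℝ, b = r • a := by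
  classical
  -- The ray c + r • u meets the hyperplanes of a and b at one parameter only if c is orthogonal to
  -- this combination; generic c allows that only when the combination is zero, that is, for
  -- parallel a and b.
  let Z : Finset (Fin n → ℝ) :=
    ((S ×ˢ S).image fun p => (u ⬝ᵥ p.2) • p.1 - (u ⬝ᵥ p.1) • p.2).erase 0
  obtain ⟨c, hcP, hcZ⟩ := exists_generic (S ∪ Finset.univ.image fun i => Pi.single i 1)
    (c₀ := c₀) (by
      intro p hp
      rcases Finset.mem_union.1 hp with hp | hp
      · exact hc₀S p hp
      · obtain ⟨i, -, rfl⟩ := Finset.mem_image.1 hp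
        simpa using hc₀ i) Z fun z hz => Finset.ne_of_mem_erase hz
  have hcS : ∀ a ∈ S, 0 < c ⬝ᵥ a := fun a ha => hcP a (Finset.mem_union_left _ ha)
  have hcpos : ∀ i, 0 < c i := by
    intro i
    have := hcP _ (Finset.mem_union_right _ (Finset.mem_image_of_mem _ (Finset.mem_univ i)))
    simpa using this
  have hne : {a ∈ S | u ⬝ᵥ a < 0}.Nonempty := by
    by_contra h
    refine huS fun a ha => not_lt.1 fun hlt => h ⟨a, Finset.mem_filter.2 ⟨ha, hlt⟩⟩
  -- The minimal ratio is the parameter at which the ray first hits a constraint hyperplane.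
  obtain ⟨a, ha, hmin⟩ := Finset.exists_min_image _ (fun a => (c ⬝ᵥ a) / -(u ⬝ᵥ a)) hne
  obtain ⟨haS, hau⟩ := Finset.mem_filter.1 ha
  set r := (c ⬝ᵥ a) / -(u ⬝ᵥ a) with hr
  have hau' : 0 < -(u ⬝ᵥ a) := neg_pos.2 hau
  have hr0 : 0 < r := div_pos (hcS a haS) hau'
  have hra : c ⬝ᵥ a = r * -(u ⬝ᵥ a) := by rw [hr, div_mul_cancel₀ _ hau'.ne']
  have hw : ∀ b, (c + r • u) ⬝ᵥ b = c ⬝ᵥ b + r * (u ⬝ᵥ b) := fun b => by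
    rw [add_dotProduct, smul_dotProduct, smul_eq_mul]
  refine ⟨a, haS, hau, c + r • u, fun b hb => ?_, fun i => ?_, ?_, fun b hb h0 => ?_⟩
  · rw [hw]
    rcases lt_or_ge (u ⬝ᵥ b) 0 with hbu | hbu
    · have h1 := hmin b (Finset.mem_filter.2 ⟨hb, hbu⟩)
      rw [le_div_iff₀ (neg_pos.2 hbu)] at h1
      linarith
    · have := hcS b hb
      positivity
  · exact add_pos (hcpos i) (mul_pos hr0 (hu i))
  · rw [hw, hra]
    ring
  · rw [hw] at h0
    have hcz : c ⬝ᵥ ((u ⬝ᵥ b) • a - (u ⬝ᵥ a) • b) = 0 := by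
      rw [dotProduct_sub, dotProduct_smul, dotProduct_smul, smul_eq_mul, smul_eq_mul, hra]
      linear_combination -(u ⬝ᵥ a) * h0
    have hz : (u ⬝ᵥ b) • a - (u ⬝ᵥ a) • b = 0 := by
      by_contra hz
      exact hcZ _ (Finset.mem_erase.2 ⟨hz, Finset.mem_image.2
        ⟨(a, b), Finset.mem_product.2 ⟨haS, hb⟩, rfl⟩⟩) hcz
    refine ⟨(u ⬝ᵥ b) / (u ⬝ᵥ a), ?_⟩
    rw [sub_eq_zero] at hz
    rw [div_eq_inv_mul, ← smul_smul, hz, smul_smul, inv_mul_cancel₀ hau.ne, one_smul]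

/-- Only multiples of a are tight at w, so any small step from w orthogonal to a stays in the face;
its span is therefore the whole hyperplane. -/
theorem isFacet_vectorCone_of_exit {w : Fin n → ℝ} (hw : w ∈ dualCone (constraints m I))
    {a : Fin n → ℝ} (ha : a ∈ constraints m I) (hwa : w ⬝ᵥ a = 0)
    (h : ∀ b ∈ constraints m I, w ⬝ᵥ b = 0 → ∃ r : ℝ, b = r • a) :
    dim (vectorCone I w) + 1 = n ∧ ∀ y ∈ vectorCone I w, y ⬝ᵥ a = 0 := by
  have hE := isExtreme_vectorCone hw
  have hwF := mem_vectorCone_self I w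
  have hvan : ∀ y ∈ vectorCone I w, y ⬝ᵥ a = 0 := by
    intro y hy
    rw [vectorCone_eq (mem_normalCone_iff.2 hw)] at hy
    obtain ⟨b, -, e, he, rfl⟩ := mem_constraints.1 ha
    rw [dotProduct_expDiff, sub_eq_zero] at hwa ⊢
    exact (hy.2 b e he hwa.symm).symm
  refine ⟨?_, hvan⟩
  have hspan : Submodule.span ℝ (vectorCone I w) = hyperplane a := by
    refine le_antisymm (Submodule.span_le.2 hvan) fun z hz => ?_
    have hz0 : ∀ b ∈ constraints m I, w ⬝ᵥ b = 0 → z ⬝ᵥ b = 0 := by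
      intro b hb hwb
      obtain ⟨r, rfl⟩ := h b hb hwb
      rw [dotProduct_smul, mem_hyperplane.1 hz, smul_zero]
    obtain ⟨t, ht, ht'⟩ := ((eventually_mem_dualCone hw
      fun b hb hwb => (hz0 b hb hwb).ge).and self_mem_nhdsWithin).exists
    have h1 : w + t • z ∈ vectorCone I w := hE.mem_of_relint hwF ht fun b hb hwb => by
      rw [add_dotProduct, smul_dotProduct, hwb, hz0 b hb hwb, smul_zero, add_zero]
    have h2 := Submodule.sub_mem _ (Submodule.subset_span (R := ℝ) h1)
      (Submodule.subset_span (R := ℝ) hwF)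
    rw [add_sub_cancel_left] at h2
    have h3 := Submodule.smul_mem _ t⁻¹ h2
    rwa [smul_smul, inv_mul_cancel₀ (ne_of_gt ht'), one_smul] at h3
  have ha0 : a ≠ 0 := by
    rintro rfl
    obtain ⟨c, hc⟩ := exists_interior_point m I
    simpa using hc 0 ha
  rw [dim_eq_finrank_span hE.zero, hspan]
  exact finrank_hyperplane ha0

theorem exists_directed (m : MonomialOrder.{0, 0} (Fin n)) (C : MaximalCone (groebnerFan I))
    (hC : C.1 ≠ dualCone (constraints m I)) : ∃ D, Directed m (groebnerFan I) C D := by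
  classical
  obtain ⟨C, hCmax⟩ := C
  obtain ⟨o, rfl⟩ := maximal_iff.1 hCmax
  -- u is interior to the cone of m and also represents m on those pairs defining the constraints of
  -- o that m orders as o does; a constraint negative at u is thus one that m reverses.
  obtain ⟨u, hu, huint, huT⟩ := exists_interior m I
    (((basisExps o I).biUnion fun b => (nf o I b).support.image fun e => (e, b)).filter
      fun p => m.toSyn p.1 < m.toSyn p.2) fun p hp => (Finset.mem_filter.1 hp).2
  have huC : u ∉ dualCone (constraints o I) := fun h =>
    hC (dualCone_eq_of_mem_interior huint h).symm
  obtain ⟨c₀, hc₀, hc₀S, -⟩ := exists_interior o I ∅ (by simp)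
  obtain ⟨a, ha, hua, w, hw, hwpos, hwa, hpar⟩ := exists_exit_point hc₀ hc₀S hu huC
  obtain ⟨hdim, hvan⟩ := isFacet_vectorCone_of_exit hw ha hwa hpar
  have hF₁ := isFacet_constraints_iff.2 ⟨isExtreme_vectorCone hw, hdim⟩
  -- The neighbouring cone: w is positive, so w-degree followed by (-a)-degree refines to a term
  -- order whose cone contains w and points just beyond the facet.
  obtain ⟨o', hw', hev⟩ := exists_mem_normalCone hwpos (-a) I
  have hF₂ := isFacet_constraints_iff.2 ⟨isExtreme_vectorCone hw', hdim⟩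
  have hne : dualCone (constraints o I) ≠ dualCone (constraints o' I) := by
    intro h
    rw [← h] at hev
    obtain ⟨t, ht, ht'⟩ := (hev.and self_mem_nhdsWithin).exists
    have ht' : 0 < t := ht'
    have h1 := ht a ha
    rw [add_dotProduct, hwa, zero_add, smul_dotProduct, neg_dotProduct, smul_eq_mul] at h1
    have h2 : 0 < a ⬝ᵥ a := by
      refine lt_of_le_of_ne (Finset.sum_nonneg fun i _ => mul_self_nonneg _) fun h => ?_
      rw [dotProduct_self_eq_zero.1 h.symm] at hua
      simp at hua
    nlinarith
  obtain ⟨b, hb, e, he, rfl⟩ := mem_constraints.1 ha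
  have hlt : m.toSyn b < m.toSyn e := by
    rw [dotProduct_expDiff, sub_neg] at hua
    rcases lt_trichotomy (m.toSyn b) (m.toSyn e) with h | h | h
    · exact h
    · rw [m.toSyn.injective h] at hua
      exact absurd hua (lt_irrefl _)
    · refine absurd (huT (e, b) (Finset.mem_filter.2 ⟨?_, h⟩)) (not_lt.2 hua.le)
      exact Finset.mem_biUnion.2 ⟨b, hb, Finset.mem_image_of_mem _ he⟩
  refine ⟨⟨dualCone (constraints o' I), maximal_iff.2 ⟨o', rfl⟩⟩,
    ⟨fun h => hne (congrArg Subtype.val h), _, hF₁, hF₂⟩, _, hF₁, hF₂, b, e, ?_, hlt⟩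
  exact (isNormalFromTo_of_constraint hne hF₁ hF₂ ha hvan).1

theorem isSink_directed_iff (m : MonomialOrder.{0, 0} (Fin n)) (C : MaximalCone (groebnerFan I)) :
    IsSink (Directed m (groebnerFan I)) C ↔ C.1 = termCone I m := by
  rw [termCone_eq]
  refine ⟨fun h => ?_, isSink_directed_of_eq m I C⟩
  by_contra hne
  obtain ⟨D, hD⟩ := exists_directed m C hne
  exact h D hD

theorem maximal_termCone (m : MonomialOrder.{0, 0} (Fin n)) (I : Ideal (MvPolynomial (Fin n) k)) :
    Maximal (fun D => D ∈ groebnerFan I) (termCone I m) :=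
  maximal_iff.2 ⟨m, termCone_eq m I⟩

end GFan

theorem mainTheorem2 {n : ℕ} {k : Type*} [Field k] (I : Ideal (MvPolynomial (Fin n) k)) :
    GFan.HasReverseSearchProperty (GFan.groebnerFan I) ∧
      ∀ m : MonomialOrder.{0, 0} (Fin n),
        ∃ h : Maximal (fun D => D ∈ GFan.groebnerFan I) (GFan.termCone I m),
          ∀ C : GFan.MaximalCone (GFan.groebnerFan I),
            GFan.IsSink (GFan.Directed m (GFan.groebnerFan I)) C ↔ C = ⟨GFan.termCone I m, h⟩ := by
  have hsink : ∀ (m : MonomialOrder.{0, 0} (Fin n)) (C : GFan.MaximalCone (GFan.groebnerFan I)),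
      GFan.IsSink (GFan.Directed m (GFan.groebnerFan I)) C ↔
        C = ⟨GFan.termCone I m, GFan.maximal_termCone m I⟩ := fun m C =>
    (GFan.isSink_directed_iff m C).trans ⟨fun h => Subtype.ext h, fun h => congrArg Subtype.val h⟩
  refine ⟨⟨GFan.isFan_groebnerFan I, GFan.isPureFullDimensional_groebnerFan I,
    GFan.hasRationalNormals_groebnerFan I, fun m => GFan.isOrientationOf_directed m I,
    fun m => GFan.isAcyclicRel_directed m I, fun m => ?_⟩,
    fun m => ⟨GFan.maximal_termCone m I, hsink m⟩⟩
  exact ⟨_, (hsink m _).2 rfl, fun C hC => (hsink m C).1 hC⟩
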